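/- Let $M$ and $N$ be smooth manifolds without boundary (Hausdorff, second countable), $\dim M=n+p$, $\dim N=p\ge 1$, with smooth Riemannian metrics $g_0$ on $M$ and $g_N$ on $N$, and let $\pi:(M,g_0)\to(N,g_N)$ be a Riemannian submersion, i.e. $\pi$ is smooth, $\pi_*$ has rank $p$ everywhere, and $g_0(u,v)=g_N(\pi_*u,\pi_*v)$ for all $x\in M$ and all $u,v\in T_xM$ that are $g_0$-orthogonal to the vertical distribution $\mathcal V=\ker\pi_*$. For $b\in N$ let $\mathcal F_b=\pi^{-1}(b)$. For a metric $g$ on $M$ with Levi-Civita connection $\nabla$ for which $\pi:(M,g)\to(N,g_N)$ is a Riemannian submersion, the second fundamental form of the fibers is $h(X,Y)=P_{\mathcal H}\nabla_XY$ for vertical vector fields $X,Y$, where $P_{\mathcal H}$ is the $g$-orthogonal projection onto the $g$-orthogonal complement of $\mathcal V$; the mean curvature is $H=\sum_{a=1}^n h(E_a,E_a)$ for $g$-orthonormal vertical $E_1,\dots,E_n$; the fibers are totally umbilical if $h(X,Y)=\frac1n g(X,Y)H$ for all vertical $X,Y$. Assume that the fibers of $\pi:(M,g_0)\to(N,g_N)$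 are totally umbilical. An *umbilical variation* is a family $\{g_t,\ t\in(-\epsilon,\epsilon)\}$, for some $\epsilon>0$, of Riemannian metrics on $M$, smooth in $(t,x)$, equal to $g_0$ at $t=0$, such that for all $t\in(-\epsilon,\epsilon)$: $g_t(X,Y)=g_0(X,Y)$ for all vertical $X,Y$, and $\pi:(M,g_t)\to(N,g_N)$ is a Riemannian submersion with totally umbilical fibers. It is *non-trivial* if $g_t\neq g_0$ for some $t\in(-\epsilon,\epsilon)$. A smooth vertical vector field $\xi$ on $M$ is *non-trivial* if it is not identically zero, *bounded* if $g_0(\xi,\xi)$ is a bounded function on $M$, and *conformal Killing on $\mathcal F_b$* if there is a function $f$ on $\mathcal F_b$ such that $(\mathcal L_\xi g_0)(X,Y)=f\,g_0(X,Y)$ along $\mathcal F_b$ for all vertical $X,Y$, i.e. if $\xi|_{\mathcal F_b}$ is a conformal Killing field of $(\mathcal F_b,g_0|_{\mathcal F_b})$. Then: 1. If there exists a non-trivial umbilical variation, then there exists a non-trivial smooth vertical vector field $\xi$ on $M$ that is conformal Killing on $\mathcal F_b$ for every $b\in N$. 2. If there exists a non-trivial bounded smooth vertical vector field $\xi$ on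 $M$ that is conformal Killing on $\mathcal F_b$ for every $b\in N$, then there exists a non-trivial umbilical variation. -/

import Mathlib

open scoped Manifold ContDiff

noncomputable section

namespace RiemSub

open Bundle VectorField FiberBundle

/-- Smooth Riemannian metrics on a smooth manifold `M` without boundary, modelled on `E`. -/
abbrev Metric (E : Type*) [NormedAddCommGroup E] [NormedSpace ℝ E]
    (M : Type*) [TopologicalSpace M] [ChartedSpace E M] [IsManifold 𝓘(ℝ, E) ∞ M] :=
  ContMDiffRiemannianMetric 𝓘(ℝ, E) ∞ E (fun x : M ↦ TangentSpace 𝓘(ℝ, E) x)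

section LeviCivita

variable {E : Type*} [NormedAddCommGroup E] [NormedSpace ℝ E]
  {M : Type*} [TopologicalSpace M] [ChartedSpace E M] [IsManifold 𝓘(ℝ, E) ∞ M]

/-! ### The Levi-Civita connection

The connection is characterised as the torsion-free metric connection; the Koszul formula below
serves only to show that it exists. -/

theorem mdiffAt_inner (g : Metric E M) {Y Z : Π x : M, TangentSpace 𝓘(ℝ, E) x} {x : M}
    (hY : MDiffAt (T% Y) x) (hZ : MDiffAt (T% Z) x) :
    MDiffAt (fun y ↦ g.inner y (Y y) (Z y)) x := by
  have : MDifferentiableAt 𝓘(ℝ, E) (𝓘(ℝ, E).prod 𝓘(ℝ))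
      (fun m ↦ TotalSpace.mk' ℝ (E := Bundle.Trivial M ℝ) m (g.inner m (Y m) (Z m))) x := by
    apply MDifferentiableAt.clm_bundle_apply₂ (F₁ := E) (F₂ := E)
    · exact (g.contMDiff.mdifferentiable (by simp)) x
    · exact hY
    · exact hZ
  simp only [mdifferentiableAt_totalSpace] at this
  exact this.2

instance instFiniteDimensionalTangentSpace [FiniteDimensional ℝ E] (x : M) :
    FiniteDimensional ℝ (TangentSpace 𝓘(ℝ, E) x) :=
  inferInstanceAs (FiniteDimensional ℝ E)

instance instT2SpaceTangentSpace (x : M) : T2Space (TangentSpace 𝓘(ℝ, E) x) :=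
  inferInstanceAs (T2Space E)

/-- The metric at a point, as a bilinear form in the sense of linear algebra. -/
def bilin (g : Metric E M) (x : M) : LinearMap.BilinForm ℝ (TangentSpace 𝓘(ℝ, E) x) :=
  LinearMap.mk₂ ℝ (fun u v ↦ g.inner x u v) (by simp) (by simp) (by simp) (by simp)

theorem bilin_isRefl (g : Metric E M) (x : M) : (bilin g x).IsRefl := by
  intro u v h
  have h' : g.inner x u v = 0 := h
  change g.inner x v u = 0
  rw [g.symm x v u, h']

theorem eq_zero_of_bilin_self (g : Metric E M) {x : M} {u : TangentSpace 𝓘(ℝ, E) x}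
    (h : bilin g x u u = 0) : u = 0 := by
  by_contra hu
  exact (g.pos x u hu).ne' h

theorem bilin_nondegenerate (g : Metric E M) (x : M) : (bilin g x).Nondegenerate :=
  ⟨fun u h ↦ eq_zero_of_bilin_self g (h u), fun u h ↦ eq_zero_of_bilin_self g (h u)⟩

theorem exists_riesz [FiniteDimensional ℝ E] (g : Metric E M) (x : M)
    (B : TangentSpace 𝓘(ℝ, E) x →L[ℝ] TangentSpace 𝓘(ℝ, E) x →L[ℝ] ℝ) :
    ∃ L : TangentSpace 𝓘(ℝ, E) x →L[ℝ] TangentSpace 𝓘(ℝ, E) x, ∀ u w,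
      g.inner x (L u) w = B u w := by
  let B₁ : LinearMap.BilinForm ℝ (TangentSpace 𝓘(ℝ, E) x) :=
    LinearMap.mk₂ ℝ (fun u v ↦ B u v) (by simp) (by simp) (by simp) (by simp)
  refine ⟨LinearMap.toContinuousLinearMap
    (B₁.symmCompOfNondegenerate (bilin g x) (bilin_nondegenerate g x)), fun u w ↦ ?_⟩
  exact LinearMap.congr_fun
    (LinearMap.BilinForm.comp_symmCompOfNondegenerate_apply B₁ (bilin_nondegenerate g x) u) w

/-- The right-hand side of the Koszul formula for `g (∇_X Y, Z)`. -/
def koszul (g : Metric E M) (X Y Z : Π x : M, TangentSpace 𝓘(ℝ, E) x) (x : M) : ℝ :=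
  (mvfderiv 𝓘(ℝ, E) (fun y ↦ g.inner y (Y y) (Z y)) x (X x)
    + mvfderiv 𝓘(ℝ, E) (fun y ↦ g.inner y (X y) (Z y)) x (Y x)
    - mvfderiv 𝓘(ℝ, E) (fun y ↦ g.inner y (X y) (Y y)) x (Z x)
    + g.inner x (mlieBracket 𝓘(ℝ, E) X Y x) (Z x)
    + g.inner x (mlieBracket 𝓘(ℝ, E) Z X x) (Y x)
    + g.inner x (mlieBracket 𝓘(ℝ, E) Z Y x) (X x)) / 2

theorem koszul_tensorial_left [FiniteDimensional ℝ E] (g : Metric E M)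
    {Y Z : Π x : M, TangentSpace 𝓘(ℝ, E) x} {x : M}
    (hY : MDiffAt (T% Y) x) (hZ : MDiffAt (T% Z) x) :
    TensorialAt 𝓘(ℝ, E) E (fun X ↦ koszul g X Y Z x) x where
  smul {f X} hf hX := by
    simp only [koszul, Pi.smul_apply', mlieBracket_smul_left hf hX, mlieBracket_smul_right hf hX,
      map_smul, map_add, smul_apply, add_apply, smul_eq_mul]
    rw [mvfderiv_fun_mul hf (mdiffAt_inner g hX hY), mvfderiv_fun_mul hf (mdiffAt_inner g hX hZ)]
    have e := g.symm x (X x) (Y x)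
    have e' := g.symm x (X x) (Z x)
    simp
    rw [e, e']
    ring
  add {X X'} hX hX' := by
    simp only [koszul, Pi.add_apply, mlieBracket_add_left hX hX', mlieBracket_add_right hX hX',
      map_add, add_apply]
    rw [mvfderiv_fun_add (mdiffAt_inner g hX hY) (mdiffAt_inner g hX' hY),
      mvfderiv_fun_add (mdiffAt_inner g hX hZ) (mdiffAt_inner g hX' hZ)]
    simp
    ring

theorem koszul_tensorial_right [FiniteDimensional ℝ E] (g : Metric E M)
    {X Y : Π x : M, TangentSpace 𝓘(ℝ, E) x} {x : M}
    (hX : MDiffAt (T% X) x) (hY : MDiffAt (T% Y) x) :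
    TensorialAt 𝓘(ℝ, E) E (fun Z ↦ koszul g X Y Z x) x where
  smul {f Z} hf hZ := by
    simp only [koszul, Pi.smul_apply', mlieBracket_smul_left hf hZ,
      map_smul, map_add, smul_apply, add_apply, smul_eq_mul]
    rw [mvfderiv_fun_mul hf (mdiffAt_inner g hX hZ), mvfderiv_fun_mul hf (mdiffAt_inner g hY hZ)]
    have e := g.symm x (Z x) (Y x)
    have e' := g.symm x (Z x) (X x)
    simp
    rw [e, e']
    ring
  add {Z Z'} hZ hZ' := by
    simp only [koszul, Pi.add_apply, mlieBracket_add_left hZ hZ', map_add, add_apply]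
    rw [mvfderiv_fun_add (mdiffAt_inner g hX hZ) (mdiffAt_inner g hX hZ'),
      mvfderiv_fun_add (mdiffAt_inner g hY hZ) (mdiffAt_inner g hY hZ')]
    simp
    ring

theorem koszul_add_mid [FiniteDimensional ℝ E] (g : Metric E M)
    {X Y Y' Z : Π x : M, TangentSpace 𝓘(ℝ, E) x} {x : M} (hX : MDiffAt (T% X) x)
    (hY : MDiffAt (T% Y) x) (hY' : MDiffAt (T% Y') x) (hZ : MDiffAt (T% Z) x) :
    koszul g X (Y + Y') Z x = koszul g X Y Z x + koszul g X Y' Z x := by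
  simp only [koszul, Pi.add_apply, mlieBracket_add_right hY hY', map_add, add_apply]
  rw [mvfderiv_fun_add (mdiffAt_inner g hY hZ) (mdiffAt_inner g hY' hZ),
    mvfderiv_fun_add (mdiffAt_inner g hX hY) (mdiffAt_inner g hX hY')]
  simp
  ring

theorem koszul_smul_mid [FiniteDimensional ℝ E] (g : Metric E M) {f : M → ℝ}
    {X Y Z : Π x : M, TangentSpace 𝓘(ℝ, E) x} {x : M} (hf : MDiffAt f x) (hX : MDiffAt (T% X) x)
    (hY : MDiffAt (T% Y) x) (hZ : MDiffAt (T% Z) x) :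
    koszul g X (f • Y) Z x
      = f x * koszul g X Y Z x + mvfderiv 𝓘(ℝ, E) f x (X x) * g.inner x (Y x) (Z x) := by
  simp only [koszul, Pi.smul_apply', mlieBracket_smul_right hf hY,
    map_smul, map_add, smul_apply, add_apply, smul_eq_mul]
  rw [mvfderiv_fun_mul hf (mdiffAt_inner g hY hZ), mvfderiv_fun_mul hf (mdiffAt_inner g hX hY)]
  have e := g.symm x (Y x) (X x)
  simp
  rw [e]
  ring

/-- `cov` is a Levi-Civita connection of `g`: it is torsion-free and compatible with `g`, i.e.
`X (g (Y, Z)) = g (∇_X Y, Z) + g (Y, ∇_X Z)`. In Mathlib `∇_X Y` at `x` is `cov Y x (X x)`. -/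
def IsLeviCivita [FiniteDimensional ℝ E] (g : Metric E M)
    (cov : CovariantDerivative 𝓘(ℝ, E) E (TangentSpace 𝓘(ℝ, E) : M → Type _)) : Prop :=
  cov.torsion = 0 ∧
    ∀ (x : M) (u : TangentSpace 𝓘(ℝ, E) x) (Y Z : Π y : M, TangentSpace 𝓘(ℝ, E) y),
      MDiffAt (T% Y) x → MDiffAt (T% Z) x →
      mvfderiv 𝓘(ℝ, E) (fun y ↦ g.inner y (Y y) (Z y)) x u
        = g.inner x (cov Y x u) (Z x) + g.inner x (Y x) (cov Z x u)

theorem eq_of_inner_eq (g : Metric E M) {x : M} {u v : TangentSpace 𝓘(ℝ, E) x}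
    (h : ∀ w, g.inner x u w = g.inner x v w) : u = v := by
  rw [← sub_eq_zero]
  refine eq_zero_of_bilin_self g ?_
  change g.inner x (u - v) (u - v) = 0
  rw [map_sub (g.inner x), sub_apply, h, sub_self]

theorem exists_isLeviCivita [FiniteDimensional ℝ E] (g : Metric E M) :
    ∃ cov : CovariantDerivative 𝓘(ℝ, E) E (TangentSpace 𝓘(ℝ, E) : M → Type _),
      IsLeviCivita g cov := by
  have key : ∀ (Y : Π x : M, TangentSpace 𝓘(ℝ, E) x) (x : M),
      ∃ L : TangentSpace 𝓘(ℝ, E) x →L[ℝ] TangentSpace 𝓘(ℝ, E) x, MDiffAt (T% Y) x →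
        ∀ X Z : Π x : M, TangentSpace 𝓘(ℝ, E) x, MDiffAt (T% X) x → MDiffAt (T% Z) x →
          g.inner x (L (X x)) (Z x) = koszul g X Y Z x := by
    intro Y x
    by_cases hY : MDiffAt (T% Y) x
    · obtain ⟨L, hL⟩ := exists_riesz g x (TensorialAt.mkHom₂ (fun X Z ↦ koszul g X Y Z x) x
        (fun Z hZ ↦ koszul_tensorial_left g hY hZ) (fun X hX ↦ koszul_tensorial_right g hX hY))
      refine ⟨L, fun _ X Z hX hZ ↦ ?_⟩
      rw [hL]
      exact TensorialAt.mkHom₂_apply _ _ hX hZ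
    · exact ⟨0, fun h ↦ absurd h hY⟩
  choose L hL using key
  have ext_smooth (x : M) (u : TangentSpace 𝓘(ℝ, E) x) : MDiffAt (T% (extend E u)) x :=
    mdifferentiableAt_extend ..
  have hL' (Y : Π x : M, TangentSpace 𝓘(ℝ, E) x) (x : M) (hY : MDiffAt (T% Y) x)
      (u w : TangentSpace 𝓘(ℝ, E) x) :
      g.inner x (L Y x u) w = koszul g (extend E u) Y (extend E w) x := by
    have := hL Y x hY (extend E u) (extend E w) (ext_smooth x u) (ext_smooth x w)
    simpa using this
  let cov : CovariantDerivative 𝓘(ℝ, E) E (TangentSpace 𝓘(ℝ, E) : M → Type _) :=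
    { toFun := L
      isCovariantDerivativeOnUniv :=
        { add := by
            intro Y Y' x hY hY' _
            ext1 u
            refine eq_of_inner_eq g fun w ↦ ?_
            rw [hL' _ _ (mdifferentiableAt_add_section hY hY'), add_apply, map_add, add_apply,
              hL' _ _ hY, hL' _ _ hY']
            exact koszul_add_mid g (ext_smooth x u) hY hY' (ext_smooth x w)
          leibniz := by
            intro Y f x hY hf _
            ext1 u
            refine eq_of_inner_eq g fun w ↦ ?_
            rw [hL' _ _ (hf.smul_section hY)]
            have := koszul_smul_mid g hf (ext_smooth x u) hY (ext_smooth x w)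
            rw [this, ← hL' _ _ hY]
            simp } }
  refine ⟨cov, ?_, ?_⟩
  · rw [CovariantDerivative.torsion_eq_zero_iff]
    intro X Y x hX hY
    refine eq_of_inner_eq g fun w ↦ ?_
    have hw := ext_smooth x w
    have h1 := hL Y x hY X _ hX hw
    have h2 := hL X x hX Y _ hY hw
    simp only [extend_apply_self] at h1 h2
    rw [map_sub, sub_apply]
    change g.inner x (L Y x (X x)) w - g.inner x (L X x (Y x)) w = _
    rw [h1, h2]
    have e : (fun y ↦ g.inner y (X y) (Y y)) = fun y ↦ g.inner y (Y y) (X y) :=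
      funext fun y ↦ g.symm y _ _
    simp only [koszul, extend_apply_self, e, mlieBracket_swap_apply (V := Y) (W := X), map_neg,
      neg_apply]
    ring
  · intro x u Y Z hY hZ
    have hu := ext_smooth x u
    have h1 := hL Y x hY _ Z hu hZ
    have h2 := hL Z x hZ _ Y hu hY
    simp only [extend_apply_self] at h1 h2
    change _ = g.inner x (L Y x u) (Z x) + g.inner x (Y x) (L Z x u)
    rw [g.symm x (Y x) (L Z x u), h1, h2]
    have e : (fun y ↦ g.inner y (Z y) (Y y)) = fun y ↦ g.inner y (Y y) (Z y) :=
      funext fun y ↦ g.symm y _ _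
    simp only [koszul, extend_apply_self, e, mlieBracket_swap_apply (V := Y) (W := Z),
      mlieBracket_swap_apply (V := extend E u) (W := Z),
      mlieBracket_swap_apply (V := extend E u) (W := Y), map_neg, neg_apply]
    ring

/-- The Levi-Civita connection of `g`. -/
def leviCivita [FiniteDimensional ℝ E] (g : Metric E M) :
    CovariantDerivative 𝓘(ℝ, E) E (TangentSpace 𝓘(ℝ, E) : M → Type _) :=
  (exists_isLeviCivita g).choose

end LeviCivita

section Submersion

variable {E : Type*} [NormedAddCommGroup E] [NormedSpace ℝ E]
  {M : Type*} [TopologicalSpace M] [ChartedSpace E M] [IsManifold 𝓘(ℝ, E) ∞ M]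
  (F : Type*) [NormedAddCommGroup F] [NormedSpace ℝ F]
  {N : Type*} [TopologicalSpace N] [ChartedSpace F N]

/-! ### Riemannian submersions and the second fundamental form of the fibers -/

/-- The vertical distribution `ker pi_*`. -/
def vertical (pi : M → N) (x : M) : Submodule ℝ (TangentSpace 𝓘(ℝ, E) x) :=
  LinearMap.ker (mfderiv 𝓘(ℝ, E) 𝓘(ℝ, F) pi x).toLinearMap

/-- The `g`-horizontal distribution, the `g`-orthogonal complement of the vertical one. -/
def horizontal (g : Metric E M) (pi : M → N) (x : M) : Submodule ℝ (TangentSpace 𝓘(ℝ, E) x) :=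
  (bilin g x).orthogonal (vertical F pi x)

theorem isCompl_horizontal_vertical [FiniteDimensional ℝ E] (g : Metric E M) (pi : M → N) (x : M) :
    IsCompl (horizontal F g pi x) (vertical F pi x) := by
  refine ((LinearMap.BilinForm.isCompl_orthogonal_iff_disjoint (bilin_isRefl g x)).2 ?_).symm
  rw [Submodule.disjoint_def]
  exact fun u hu hu' ↦ eq_zero_of_bilin_self g (hu' u hu)

/-- The `g`-orthogonal projection onto the `g`-horizontal distribution. -/
def horizontalProj [FiniteDimensional ℝ E] (g : Metric E M) (pi : M → N) (x : M) :
    TangentSpace 𝓘(ℝ, E) x →ₗ[ℝ] TangentSpace 𝓘(ℝ, E) x :=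
  Submodule.projection _ _ (isCompl_horizontal_vertical F g pi x)

variable {F} in
/-- `pi : (M, g) → (N, gN)` is a Riemannian submersion: `pi` is smooth, `pi_*` has rank `dim N`
everywhere, and `pi_*` is isometric on `g`-horizontal vectors. -/
structure IsRiemannianSubmersion [IsManifold 𝓘(ℝ, F) ∞ N] (g : Metric E M) (gN : Metric F N)
    (pi : M → N) : Prop where
  contMDiff : ContMDiff 𝓘(ℝ, E) 𝓘(ℝ, F) ∞ pi
  surjective : ∀ x, Function.Surjective (mfderiv 𝓘(ℝ, E) 𝓘(ℝ, F) pi x)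
  isometry : ∀ x, ∀ u ∈ horizontal F g pi x, ∀ v ∈ horizontal F g pi x,
    g.inner x u v
      = gN.inner (pi x) (mfderiv 𝓘(ℝ, E) 𝓘(ℝ, F) pi x u) (mfderiv 𝓘(ℝ, E) 𝓘(ℝ, F) pi x v)

/-- `X` is a smooth vertical vector field on `M`. -/
structure IsVerticalField (pi : M → N) (X : Π x : M, TangentSpace 𝓘(ℝ, E) x) : Prop where
  contMDiff : ContMDiff 𝓘(ℝ, E) 𝓘(ℝ, E).tangent ∞
    (fun x ↦ (⟨x, X x⟩ : TangentBundle 𝓘(ℝ, E) M))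
  mem_vertical : ∀ x, X x ∈ vertical F pi x

/-- The second fundamental form `h (X, Y) = P_H (∇_X Y)` of the fibers of `pi : (M, g) → N`,
evaluated at `x`, for vertical vector fields `X`, `Y`. -/
def secondFundamentalForm [FiniteDimensional ℝ E] (g : Metric E M) (pi : M → N)
    (X Y : Π x : M, TangentSpace 𝓘(ℝ, E) x) (x : M) : TangentSpace 𝓘(ℝ, E) x :=
  horizontalProj F g pi x (leviCivita g Y x (X x))

/-- The fibers, of dimension `n`, of `pi : (M, g) → N` are totally umbilical:
`h (X, Y) = (1 / n) g (X, Y) H` for all vertical fields `X`, `Y`. Here `H` at `x` is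
`∑ a, h (e a, e a)` for vertical fields `e a` that are orthonormal at `x`. Since `h` is a tensor on
the vertical distribution, only the values of the `e a` at `x` enter, so that
it makes no difference whether they are also orthonormal near `x`. -/
def HasTotallyUmbilicalFibers [FiniteDimensional ℝ E] (n : ℕ) (g : Metric E M) (pi : M → N) :
    Prop :=
  ∀ (x : M) (e : Fin n → Π y : M, TangentSpace 𝓘(ℝ, E) y),
    (∀ a, IsVerticalField F pi (e a)) →
    (∀ a b, g.inner x (e a x) (e b x) = if a = b then 1 else 0) →
    ∀ X Y : Π y : M, TangentSpace 𝓘(ℝ, E) y, IsVerticalField F pi X → IsVerticalField F pi Y →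
      secondFundamentalForm F g pi X Y x
        = ((1 / (n : ℝ)) * g.inner x (X x) (Y x)) •
            ∑ a, secondFundamentalForm F g pi (e a) (e a) x

/-! ### Conformal Killing fields on the fibers -/

/-- The Lie derivative `(L_ξ g) (X, Y) = ξ (g (X, Y)) - g ([ξ, X], Y) - g (X, [ξ, Y])` at `x`. -/
def lieDerivMetric (g : Metric E M) (ξ X Y : Π x : M, TangentSpace 𝓘(ℝ, E) x) (x : M) : ℝ :=
  mvfderiv 𝓘(ℝ, E) (fun y ↦ g.inner y (X y) (Y y)) x (ξ x)
    - g.inner x (mlieBracket 𝓘(ℝ, E) ξ X x) (Y x)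
    - g.inner x (X x) (mlieBracket 𝓘(ℝ, E) ξ Y x)

/-- The restriction of the vertical field `ξ` to the fiber of `pi` over `b`, with the metric induced
by `g`, is conformal Killing: the Lie derivative of the induced metric with respect to `ξ` is
a multiple of the induced metric. Fields tangent to the fiber extend locally
to vertical fields on `M`, and for vertical `X`, `Y` all terms of `(L_ξ g) (X, Y)` on the fiber
are those computed from the restrictions of `ξ`, `X`, `Y`, `g` to the fiber. For fibers of positive
dimension the factor `f` is determined by the equation, hence smooth. -/
def IsConformalKillingOnFiber (g : Metric E M) (pi : M → N)
    (ξ : Π x : M, TangentSpace 𝓘(ℝ, E) x)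
    (b : N) : Prop :=
  ∃ f : pi ⁻¹' {b} → ℝ, ∀ X Y : Π x : M, TangentSpace 𝓘(ℝ, E) x,
    IsVerticalField F pi X → IsVerticalField F pi Y →
    ∀ x : pi ⁻¹' {b}, lieDerivMetric g ξ X Y x = f x * g.inner x (X x) (Y x)

/-! ### Variations of the metric -/

/-- `(g t)` for `t ∈ (-ε, ε)` is a variation of `g₀` within the metrics that agree with `g₀` on the
distribution `D`, depending smoothly on `t` (jointly with the point of `M`).
Values of `g` outside `(-ε, ε)` are irrelevant. -/
structure IsVariation (g₀ : Metric E M) (D : Π x : M, Submodule ℝ (TangentSpace 𝓘(ℝ, E) x))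
    (ε : ℝ) (g : ℝ → Metric E M) : Prop where
  pos : 0 < ε
  zero : g 0 = g₀
  contMDiffOn : ContMDiffOn (𝓘(ℝ, ℝ).prod 𝓘(ℝ, E)) (𝓘(ℝ, E).prod 𝓘(ℝ, E →L[ℝ] E →L[ℝ] ℝ)) ∞
    (fun q : ℝ × M ↦ TotalSpace.mk' (E →L[ℝ] E →L[ℝ] ℝ)
      (E := fun x : M ↦ TangentSpace 𝓘(ℝ, E) x →L[ℝ] TangentSpace 𝓘(ℝ, E) x →L[ℝ] ℝ)
      q.2 ((g q.1).inner q.2))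
    (Set.Ioo (-ε) ε ×ˢ Set.univ)
  eq_on : ∀ t ∈ Set.Ioo (-ε) ε, ∀ x, ∀ u ∈ D x, ∀ v ∈ D x,
    (g t).inner x u v = g₀.inner x u v

variable {F} in
/-- There is a non-trivial variation of `g₀`, fixed on the vertical distribution, all of whose
metrics make `pi` a Riemannian submersion with totally umbilical fibers. -/
def ExistsUmbilicalVariation [FiniteDimensional ℝ E] [IsManifold 𝓘(ℝ, F) ∞ N] (n : ℕ)
    (g₀ : Metric E M) (gN : Metric F N) (pi : M → N) : Prop :=
  ∃ (ε : ℝ) (g : ℝ → Metric E M),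
    IsVariation g₀ (vertical F pi) ε g ∧
    (∃ t ∈ Set.Ioo (-ε) ε, g t ≠ g₀) ∧
    ∀ t ∈ Set.Ioo (-ε) ε, IsRiemannianSubmersion (g t) gN pi ∧
      HasTotallyUmbilicalFibers F n (g t) pi

end Submersion

end RiemSub

end

/-! The proof rests on one identity: for vertical $X,Y$ and a basic field $Z$ (horizontal and
$\pi$-related to a field $W$ on $N$), $g(h(X,Y),Z)=-\frac12(\mathcal L_Zg)(X,Y)$
(`inner_secondFundamentalForm`). Basic fields realise every horizontal vector, so the fibers are
umbilical exactly when $\mathcal L_Zg$ is pointwise a multiple of $g$ on vertical vectors, for every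
basic $Z$. Since $[Z,X]$ is vertical, this Lie derivative sees only the metric of the fibers, which
a variation keeps fixed.

A submersion metric is determined by its fiber metric and its horizontal spaces. If $g_t\ne g_0$,
the horizontal spaces therefore differ somewhere, and some $W$ has two different lifts $Z',Z$. Their
difference $\xi=Z'-Z$ is vertical, and $\mathcal L_\xi g_0=\mathcal L_{Z'}g_t-\mathcal L_Zg_0$ on
vertical vectors is a multiple of $g_0$ (`IsRiemannianSubmersion.exists_conformalKilling`).

Conversely, given $\xi$, fix a basic field $B$ over some $W$ and pull $g_0$ back under the shear
$A_su=u-s\,g_0(B,u)\,\xi$. It fixes vertical vectors, commutes with $\pi_*$ and has inverse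
$A_{-s}$. The new lift of $W'$ is $Z_0+\varphi\xi$, where $Z_0$ is the old lift and
$\varphi=s\,g_N(W,W')\circ\pi$. As $\varphi$ is constant on fibers, $\mathcal
L_{\varphi\xi}g_0=\varphi\,\mathcal L_\xi g_0$ on vertical vectors, so umbilicity persists
(`hasTotallyUmbilicalFibers_shear`). -/

noncomputable section

namespace RiemSub

open Bundle VectorField FiberBundle Filter Topology

/-! ### Smoothness criteria for families of linear maps -/

section Smoothness

theorem contMDiffWithinAt_clm_of_apply {EX : Type*} [NormedAddCommGroup EX] [NormedSpace ℝ EX]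
    {HX : Type*} [TopologicalSpace HX] {IX : ModelWithCorners ℝ EX HX}
    {X : Type*} [TopologicalSpace X] [ChartedSpace HX X]
    {F₁ F₂ : Type*} [NormedAddCommGroup F₁] [NormedSpace ℝ F₁] [FiniteDimensional ℝ F₁]
    [NormedAddCommGroup F₂] [NormedSpace ℝ F₂] {k : ℕ∞ω} {f : X → F₁ →L[ℝ] F₂} {s : Set X} {q : X}
    (h : ∀ v, ContMDiffWithinAt IX 𝓘(ℝ, F₂) k (fun x ↦ f x v) s q) :
    ContMDiffWithinAt IX 𝓘(ℝ, F₁ →L[ℝ] F₂) k f s q := by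
  let b := Module.finBasis ℝ F₁
  have e : f = fun x ↦ ∑ i, ContinuousLinearMap.smulRightL ℝ F₁ F₂
      (LinearMap.toContinuousLinearMap (b.coord i)) (f x (b i)) := by
    ext x v
    conv_lhs => rw [← b.sum_repr v, map_sum]
    simp
  rw [e]
  refine contMDiffWithinAt_finsetSum fun i _ ↦ ?_
  exact (ContinuousLinearMap.contMDiff
    (ContinuousLinearMap.smulRightL ℝ F₁ F₂ (LinearMap.toContinuousLinearMap (b.coord i)))
    |>.contMDiffAt).comp_contMDiffWithinAt q (h (b i))

variable {EX : Type*} [NormedAddCommGroup EX] [NormedSpace ℝ EX]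
  {HX : Type*} [TopologicalSpace HX] {IX : ModelWithCorners ℝ EX HX}
  {X : Type*} [TopologicalSpace X] [ChartedSpace HX X]
  {EB : Type*} [NormedAddCommGroup EB] [NormedSpace ℝ EB]
  {HB : Type*} [TopologicalSpace HB] {IB : ModelWithCorners ℝ EB HB}
  {B : Type*} [TopologicalSpace B] [ChartedSpace HB B]
  {F₁ : Type*} [NormedAddCommGroup F₁] [NormedSpace ℝ F₁] [FiniteDimensional ℝ F₁]
  {E₁ : B → Type*} [∀ x, AddCommGroup (E₁ x)] [∀ x, Module ℝ (E₁ x)]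
  [∀ x, TopologicalSpace (E₁ x)] [TopologicalSpace (TotalSpace F₁ E₁)]
  [FiberBundle F₁ E₁] [VectorBundle ℝ F₁ E₁]
  {F₂ : Type*} [NormedAddCommGroup F₂] [NormedSpace ℝ F₂]
  {E₂ : B → Type*} [∀ x, AddCommGroup (E₂ x)] [∀ x, Module ℝ (E₂ x)]
  [∀ x, TopologicalSpace (E₂ x)] [TopologicalSpace (TotalSpace F₂ E₂)]
  [∀ x, IsTopologicalAddGroup (E₂ x)] [∀ x, ContinuousSMul ℝ (E₂ x)]
  [FiberBundle F₂ E₂] [VectorBundle ℝ F₂ E₂]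

/-- A family of linear maps between fibers is smooth if its values on the local extensions of
vectors are. -/
theorem contMDiffWithinAt_hom_of_extend {k : ℕ∞ω} {b : X → B} {φ : Π q, E₁ (b q) →L[ℝ] E₂ (b q)}
    {s : Set X} {q₀ : X} (hq : q₀ ∈ s) (hb : ContMDiffWithinAt IX IB k b s q₀)
    (h : ∀ w : E₁ (b q₀), ContMDiffWithinAt IX (IB.prod 𝓘(ℝ, F₂)) k
      (fun q ↦ (⟨b q, φ q (extend F₁ w (b q))⟩ : TotalSpace F₂ E₂)) s q₀) :
    ContMDiffWithinAt IX (IB.prod 𝓘(ℝ, F₁ →L[ℝ] F₂)) k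
      (fun q ↦ TotalSpace.mk' (F₁ →L[ℝ] F₂) (E := fun x ↦ E₁ x →L[ℝ] E₂ x) (b q) (φ q)) s q₀ := by
  rw [contMDiffWithinAt_hom_bundle]
  refine ⟨hb, contMDiffWithinAt_clm_of_apply fun v ↦ ?_⟩
  have h₁ := mem_baseSet_trivializationAt F₁ E₁ (b q₀)
  have h' := h ((trivializationAt F₁ E₁ (b q₀)).symm (b q₀) v)
  rw [contMDiffWithinAt_totalSpace] at h'
  refine h'.2.congr_of_eventuallyEq_of_mem ?_ hq
  have hb' := hb.continuousWithinAt
  filter_upwards [hb' ((trivializationAt F₁ E₁ (b q₀)).open_baseSet.mem_nhds h₁),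
    hb' ((trivializationAt F₂ E₂ (b q₀)).open_baseSet.mem_nhds
      (mem_baseSet_trivializationAt F₂ E₂ (b q₀)))] with q hq₁ hq₂
  -- The local extension of a vector has constant coordinates in the trivialization at the base
  -- point, so evaluating on it is evaluating the coordinate matrix on a fixed vector.
  simp only [Set.mem_preimage] at hq₁ hq₂
  rw [ContinuousLinearMap.inCoordinates_eq hq₁ hq₂]
  simp [extend, h₁]

end Smoothness

/-! ### Smooth vector fields on a Riemannian manifold -/

section Fields

variable {E : Type*} [NormedAddCommGroup E] [NormedSpace ℝ E]
  {M : Type*} [TopologicalSpace M] [ChartedSpace E M] [IsManifold 𝓘(ℝ, E) ∞ M]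

theorem contMDiffAt_inner {EX : Type*} [NormedAddCommGroup EX] [NormedSpace ℝ EX]
    {HX : Type*} [TopologicalSpace HX] {IX : ModelWithCorners ℝ EX HX}
    {X : Type*} [TopologicalSpace X] [ChartedSpace HX X] (g : Metric E M) {b : X → M}
    {Y Z : Π q : X, TangentSpace 𝓘(ℝ, E) (b q)} {q : X}
    (hY : ContMDiffAt IX 𝓘(ℝ, E).tangent ∞ (fun q ↦ (⟨b q, Y q⟩ : TangentBundle 𝓘(ℝ, E) M)) q)
    (hZ : ContMDiffAt IX 𝓘(ℝ, E).tangent ∞ (fun q ↦ (⟨b q, Z q⟩ : TangentBundle 𝓘(ℝ, E) M)) q) :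
    ContMDiffAt IX 𝓘(ℝ) ∞ (fun q ↦ g.inner (b q) (Y q) (Z q)) q := by
  have hb : ContMDiffAt IX 𝓘(ℝ, E) ∞ b q := (contMDiffAt_totalSpace.1 hY).1
  have : ContMDiffAt IX (𝓘(ℝ, E).prod 𝓘(ℝ)) ∞
      (fun m ↦ TotalSpace.mk' ℝ (E := Bundle.Trivial M ℝ) (b m) (g.inner (b m) (Y m) (Z m))) q := by
    apply ContMDiffAt.clm_bundle_apply₂ (F₁ := E) (F₂ := E)
    · exact (g.contMDiff (b q)).comp q hb
    · exact hY
    · exact hZ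
  exact (contMDiffAt_totalSpace.1 this).2

theorem isInvertible_of_pos {V : Type*} [NormedAddCommGroup V] [NormedSpace ℝ V]
    [FiniteDimensional ℝ V] (A : V →L[ℝ] V →L[ℝ] ℝ) (hA : ∀ v, v ≠ 0 → 0 < A v v) :
    A.IsInvertible := by
  have hinj : Function.Injective A.toLinearMap := by
    rw [← LinearMap.ker_eq_bot, LinearMap.ker_eq_bot']
    intro v hv
    by_contra h
    have : A v = 0 := hv
    simpa [this] using hA v h
  have hfin : Module.finrank ℝ V = Module.finrank ℝ (V →L[ℝ] ℝ) := by
    rw [← (LinearMap.toContinuousLinearMap (𝕜 := ℝ) (E := V) (F' := ℝ)).finrank_eq]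
    exact (Subspace.dual_finrank_eq (K := ℝ) (V := V)).symm
  exact ⟨(LinearEquiv.ofInjectiveOfFinrankEq _ hinj hfin).toContinuousLinearEquiv, by ext; rfl⟩

variable [FiniteDimensional ℝ E]

/-- A vector field is smooth if its inner products with the local extensions of vectors are. -/
theorem contMDiffAt_of_inner (g : Metric E M) {X : Π x : M, TangentSpace 𝓘(ℝ, E) x} {x₀ : M}
    (h : ∀ w : TangentSpace 𝓘(ℝ, E) x₀,
      ContMDiffAt 𝓘(ℝ, E) 𝓘(ℝ) ∞ (fun x ↦ g.inner x (X x) (extend E w x)) x₀) :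
    ContMDiffAt 𝓘(ℝ, E) 𝓘(ℝ, E).tangent ∞
      (fun x ↦ (⟨x, X x⟩ : TangentBundle 𝓘(ℝ, E) M)) x₀ := by
  rw [contMDiffAt_section]
  set e := trivializationAt E (TangentSpace 𝓘(ℝ, E) : M → Type _) x₀ with he
  have h₁ : x₀ ∈ e.baseSet := mem_baseSet_trivializationAt E _ x₀
  have hg := ((contMDiffAt_hom_bundle _).1 (g.contMDiff x₀)).2
  -- `G` is the Gram operator in the trivialization. The coordinates of `X` are `G⁻¹` applied to its
  -- inner products with the coordinate fields, and operator inversion is smooth at invertible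
  -- operators.
  set G : M → E →L[ℝ] E →L[ℝ] ℝ := fun x ↦ ContinuousLinearMap.inCoordinates E
    (TangentSpace 𝓘(ℝ, E) : M → Type _) (E →L[ℝ] ℝ) (fun x : M ↦ TangentSpace 𝓘(ℝ, E) x →L[ℝ] ℝ)
    x₀ x x₀ x (g.inner x) with hG
  have hGv (x : M) (hx : x ∈ e.baseSet) (u w : E) :
      G x u w = g.inner x (e.symm x u) (e.symm x w) := by
    have := inCoordinates_apply_eq₂ (F₁ := E) (F₂ := E) (F₃ := ℝ)
      (E₁ := (TangentSpace 𝓘(ℝ, E) : M → Type _)) (E₂ := (TangentSpace 𝓘(ℝ, E) : M → Type _))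
      (E₃ := Bundle.Trivial M ℝ) (x₀ := x₀) (x := x) (ϕ := g.inner x) (v := u) (w := w) hx hx
      (by simp)
    rw [hG]
    refine this.trans ?_
    simp [he]
  have hGi (x : M) (hx : x ∈ e.baseSet) : (G x).IsInvertible := by
    refine isInvertible_of_pos _ fun v hv ↦ ?_
    rw [hGv x hx]
    refine g.pos _ _ fun h0 ↦ hv ?_
    have := e.apply_mk_symm hx v
    rw [h0] at this
    have h2 := congrArg Prod.snd this
    simp only at h2
    rw [← h2]
    have := (e.continuousLinearEquivAt ℝ x hx).map_zero
    simpa using this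
  have hα : ContMDiffAt 𝓘(ℝ, E) 𝓘(ℝ, E →L[ℝ] ℝ) ∞ (fun x ↦ G x (e ⟨x, X x⟩).2) x₀ := by
    refine contMDiffWithinAt_clm_of_apply (s := Set.univ) fun v ↦ ?_
    refine (h (e.symm x₀ v)).congr_of_eventuallyEq ?_
    filter_upwards [e.open_baseSet.mem_nhds h₁] with x hx
    rw [hGv x hx]
    have : e.symm x (e ⟨x, X x⟩).2 = X x := e.symm_apply_apply_mk hx _
    rw [this]
    simp [extend, ← he, h₁]
  have hinv : ContMDiffAt 𝓘(ℝ, E) 𝓘(ℝ, (E →L[ℝ] ℝ) →L[ℝ] E) ∞ (fun x ↦ (G x).inverse) x₀ :=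
    (hGi x₀ h₁).contDiffAt_map_inverse.contMDiffAt.comp x₀ hg
  refine (hinv.clm_apply hα).congr_of_eventuallyEq ?_
  filter_upwards [e.open_baseSet.mem_nhds h₁] with x hx
  exact ((hGi x hx).inverse_apply_eq.2 rfl).symm

/-- A bump function cuts off the local extension of the vector. -/
theorem exists_contMDiff_field_eq [T2Space M] {x : M} (v : TangentSpace 𝓘(ℝ, E) x) :
    ∃ X : Π x : M, TangentSpace 𝓘(ℝ, E) x,
      ContMDiff 𝓘(ℝ, E) 𝓘(ℝ, E).tangent ∞ (fun x ↦ (⟨x, X x⟩ : TangentBundle 𝓘(ℝ, E) M)) ∧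
      X x = v := by
  obtain ⟨s, hs, hX⟩ := exists_contMDiffOn_extend (k := ∞) 𝓘(ℝ, E) E v
  obtain ⟨u, hus, hu, hxu⟩ := mem_nhds_iff.1 hs
  obtain ⟨f, hf⟩ := ((SmoothBumpFunction.nhds_basis_tsupport (I := 𝓘(ℝ, E)) x).mem_iff).1
    (hu.mem_nhds hxu)
  refine ⟨(f : M → ℝ) • extend E v, ?_, ?_⟩
  · exact ContMDiffOn.smul_section_of_tsupport (n := ∞) f.contMDiff.contMDiffOn hu hf.2 (hX.mono hus)
  · simp

end Fields

/-! ### Lie brackets of related vector fields -/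

section Bracket

variable {E : Type*} [NormedAddCommGroup E] [NormedSpace ℝ E]
  {M : Type*} [TopologicalSpace M] [ChartedSpace E M]
  {F : Type*} [NormedAddCommGroup F] [NormedSpace ℝ F]
  {N : Type*} [TopologicalSpace N] [ChartedSpace F N] [IsManifold 𝓘(ℝ, F) ∞ N]

theorem mvfderiv_extChartAt_comp {f : M → N} {x y : M}
    (hf : MDiffAt f y) (hy : f y ∈ (chartAt F (f x)).source) (u : TangentSpace 𝓘(ℝ, E) y) :
    mvfderiv 𝓘(ℝ, E) (extChartAt 𝓘(ℝ, F) (f x) ∘ f) y u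
      = mvfderiv 𝓘(ℝ, F) (extChartAt 𝓘(ℝ, F) (f x)) (f y) (mfderiv 𝓘(ℝ, E) 𝓘(ℝ, F) f y u) :=
  mfderiv_comp_apply y (mdifferentiableAt_extChartAt hy) hf u

variable [IsManifold 𝓘(ℝ, E) ∞ M]

theorem fderiv_comp_extChartAt_symm {x : M} {y : E} (hy : y ∈ (extChartAt 𝓘(ℝ, E) x).target)
    {h : M → F} (hh : MDiffAt h ((extChartAt 𝓘(ℝ, E) x).symm y))
    (V : Π x : M, TangentSpace 𝓘(ℝ, E) x) :
    fderiv ℝ (h ∘ (extChartAt 𝓘(ℝ, E) x).symm) y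
        (mpullback 𝓘(ℝ, E) 𝓘(ℝ, E) (extChartAt 𝓘(ℝ, E) x).symm V y)
      = mvfderiv 𝓘(ℝ, E) h ((extChartAt 𝓘(ℝ, E) x).symm y)
        (V ((extChartAt 𝓘(ℝ, E) x).symm y)) := by
  have hi := isInvertible_mfderivWithin_extChartAt_symm hy
  have hd := mdifferentiableWithinAt_extChartAt_symm hy
  simp only [modelWithCornersSelf_coe, Set.range_id, mfderivWithin_univ,
    mdifferentiableWithinAt_univ] at hi hd
  rw [← mfderiv_eq_fderiv]
  have hc := mfderiv_comp_apply y hh hd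
    (mpullback 𝓘(ℝ, E) 𝓘(ℝ, E) (extChartAt 𝓘(ℝ, E) x).symm V y)
  have hv := hi.self_apply_inverse (V ((extChartAt 𝓘(ℝ, E) x).symm y))
  rw [mpullback_apply] at hc
  rw [hv] at hc
  exact hc

theorem contMDiffAt_mfderiv_apply {f : M → N} {W : Π x : M, TangentSpace 𝓘(ℝ, E) x} {x : M}
    (hf : ContMDiffAt 𝓘(ℝ, E) 𝓘(ℝ, F) ∞ f x)
    (hW : ContMDiffAt 𝓘(ℝ, E) 𝓘(ℝ, E).tangent ∞
      (fun y ↦ (⟨y, W y⟩ : TangentBundle 𝓘(ℝ, E) M)) x) :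
    ContMDiffAt 𝓘(ℝ, E) 𝓘(ℝ, F).tangent ∞
      (fun y ↦ (⟨f y, mfderiv 𝓘(ℝ, E) 𝓘(ℝ, F) f y (W y)⟩ : TangentBundle 𝓘(ℝ, F) N)) x :=
  (hf.mfderiv_const (m := ∞) (by simp)).clm_apply_of_inCoordinates hW hf

variable [CompleteSpace E]

/-- `[V, W] f = V (W f) - W (V f)`. -/
theorem mvfderiv_mlieBracket {V W : Π x : M, TangentSpace 𝓘(ℝ, E) x} {x : M} {f : M → F}
    (hf : ContMDiffAt 𝓘(ℝ, E) 𝓘(ℝ, F) ∞ f x) (hV : MDiffAt (T% V) x) (hW : MDiffAt (T% W) x)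
    (hfV : MDiffAt (fun y ↦ mvfderiv 𝓘(ℝ, E) f y (V y)) x)
    (hfW : MDiffAt (fun y ↦ mvfderiv 𝓘(ℝ, E) f y (W y)) x) :
    mvfderiv 𝓘(ℝ, E) f x (mlieBracket 𝓘(ℝ, E) V W x)
      = mvfderiv 𝓘(ℝ, E) (fun y ↦ mvfderiv 𝓘(ℝ, E) f y (W y)) x (V x)
        - mvfderiv 𝓘(ℝ, E) (fun y ↦ mvfderiv 𝓘(ℝ, E) f y (V y)) x (W x) := by
  set φ := extChartAt 𝓘(ℝ, E) x with hφ
  have hp : φ x ∈ φ.target := mem_extChartAt_target x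
  have hx : φ.symm (φ x) = x := extChartAt_to_inv x
  have ht : φ.target ∈ 𝓝 (φ x) := extChartAt_target_mem_nhds x
  have hV' := hV.mdifferentiableWithinAt (s := Set.univ)
    |>.differentiableWithinAt_mpullbackWithin_vectorField
  have hW' := hW.mdifferentiableWithinAt (s := Set.univ)
    |>.differentiableWithinAt_mpullbackWithin_vectorField
  simp only [modelWithCornersSelf_coe, Set.range_id, mpullbackWithin_univ, Set.preimage_univ,
    Set.inter_univ, ← hφ] at hV' hW'
  have hV'' : DifferentiableAt ℝ (mpullback 𝓘(ℝ, E) 𝓘(ℝ, E) φ.symm V : E → E) (φ x) :=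
    differentiableWithinAt_univ.1 hV'
  have hW'' : DifferentiableAt ℝ (mpullback 𝓘(ℝ, E) 𝓘(ℝ, E) φ.symm W : E → E) (φ x) :=
    differentiableWithinAt_univ.1 hW'
  have hf' : ContDiffAt ℝ ∞ (f ∘ φ.symm) (φ x) := by
    have h1 : ContMDiffAt 𝓘(ℝ, E) 𝓘(ℝ, E) ∞ φ.symm (φ x) := by
      have := contMDiffWithinAt_extChartAt_symm_range (I := 𝓘(ℝ, E)) (n := ∞) x hp
      rw [modelWithCornersSelf_coe, Set.range_id] at this
      exact this
    exact (ContMDiffAt.comp_of_eq hf h1 hx).contDiffAt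
  -- In the chart this is the formula on a vector space, which comes from the symmetry of the second
  -- derivative. What follows transports each of its terms back to `M`.
  have key := fderiv_apply_lieBracket hf' (by simp; exact ENat.LEInfty.out) hW'' hV''
  have ev (U : Π x : M, TangentSpace 𝓘(ℝ, E) x) :
      (fun y ↦ fderiv ℝ (f ∘ φ.symm) y (mpullback 𝓘(ℝ, E) 𝓘(ℝ, E) φ.symm U y))
        =ᶠ[𝓝 (φ x)] (fun y ↦ mvfderiv 𝓘(ℝ, E) f y (U y)) ∘ φ.symm := by
    have hfn : ∀ᶠ y in 𝓝 x, MDiffAt f y := by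
      have h1 : ContMDiffAt 𝓘(ℝ, E) 𝓘(ℝ, F) 1 f x := hf.of_le (by simp)
      filter_upwards [(contMDiffAt_iff_contMDiffAt_nhds (by simp)).1 h1] with y hy
      exact hy.mdifferentiableAt (by simp)
    have hc : Tendsto φ.symm (𝓝 (φ x)) (𝓝 x) := by
      have := (continuousAt_extChartAt_symm (I := 𝓘(ℝ, E)) x).tendsto
      rwa [← hφ, hx] at this
    filter_upwards [ht, hc.eventually hfn] with y hy hy'
    exact fderiv_comp_extChartAt_symm hy hy' U
  rw [(ev V).fderiv_eq, (ev W).fderiv_eq] at key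
  have hb : mlieBracket 𝓘(ℝ, E) V W x = (mfderiv 𝓘(ℝ, E) 𝓘(ℝ, E) φ x).inverse
      (lieBracket ℝ (mpullback 𝓘(ℝ, E) 𝓘(ℝ, E) φ.symm V : E → E)
        (mpullback 𝓘(ℝ, E) 𝓘(ℝ, E) φ.symm W : E → E) (φ x) : E) := by
    rw [← mlieBracketWithin_univ, mlieBracketWithin_apply]
    simp only [modelWithCornersSelf_coe, Set.range_id, mpullbackWithin_univ, Set.preimage_univ,
      Set.inter_univ, ← hφ]
    exact congrArg _ (congrFun (lieBracketWithin_univ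
      (V := (mpullback 𝓘(ℝ, E) 𝓘(ℝ, E) φ.symm V : E → E))
      (W := (mpullback 𝓘(ℝ, E) 𝓘(ℝ, E) φ.symm W : E → E))) _)
  have hfd : MDiffAt f x := hf.mdifferentiableAt (by simp)
  have hφd : MDiffAt φ x := mdifferentiableAt_extChartAt (mem_chart_source E x)
  have hfφ : f =ᶠ[𝓝 x] (f ∘ φ.symm) ∘ φ := by
    filter_upwards [extChartAt_source_mem_nhds (I := 𝓘(ℝ, E)) x] with y hy
    exact congrArg f ((extChartAt 𝓘(ℝ, E) x).left_inv hy).symm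
  have hl (u : TangentSpace 𝓘(ℝ, E) x) : mvfderiv 𝓘(ℝ, E) f x u
      = fderiv ℝ (f ∘ φ.symm) (φ x) (mfderiv 𝓘(ℝ, E) 𝓘(ℝ, E) φ x u) := by
    have h1 := mfderiv_comp_apply x
      (hf'.differentiableAt (by simp)).mdifferentiableAt hφd u
    rw [mfderiv_eq_fderiv] at h1
    refine Eq.trans ?_ h1
    simp only [mvfderiv, hfφ.mfderiv_eq]
    rfl
  have hr (h : M → F) (hh : MDiffAt h x) (U : Π x : M, TangentSpace 𝓘(ℝ, E) x) :
      fderiv ℝ (h ∘ φ.symm) (φ x) (mpullback 𝓘(ℝ, E) 𝓘(ℝ, E) φ.symm U (φ x))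
        = mvfderiv 𝓘(ℝ, E) h x (U x) := by
    rw [fderiv_comp_extChartAt_symm hp (by rwa [← hφ, hx]) U]
    have : ∀ y, y = x → mvfderiv 𝓘(ℝ, E) h y (U y) = mvfderiv 𝓘(ℝ, E) h x (U x) := by
      rintro _ rfl; rfl
    exact this _ hx
  rw [hr _ hfV, hr _ hfW] at key
  rw [hl, hb]
  have hi := isInvertible_mfderiv_extChartAt (I := 𝓘(ℝ, E)) (mem_extChartAt_source x)
  exact (congrArg (fderiv ℝ (f ∘ φ.symm) (φ x)) (hi.self_apply_inverse _)).trans key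

/-- If `V` and `Z` are `f`-related to `0` and to a field `W`, then `[Z, V]` is related to `0`. -/
theorem mfderiv_mlieBracket_eq_zero {f : M → N} (hf : ContMDiff 𝓘(ℝ, E) 𝓘(ℝ, F) ∞ f)
    {V Z : Π x : M, TangentSpace 𝓘(ℝ, E) x} {W : Π y : N, TangentSpace 𝓘(ℝ, F) y} {x : M}
    (hV : MDiffAt (T% V) x) (hZ : MDiffAt (T% Z) x)
    (hW : ContMDiff 𝓘(ℝ, F) 𝓘(ℝ, F).tangent ∞ (fun y ↦ (⟨y, W y⟩ : TangentBundle 𝓘(ℝ, F) N)))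
    (hV0 : ∀ y, mfderiv 𝓘(ℝ, E) 𝓘(ℝ, F) f y (V y) = 0)
    (hZW : ∀ y, mfderiv 𝓘(ℝ, E) 𝓘(ℝ, F) f y (Z y) = W (f y)) :
    mfderiv 𝓘(ℝ, E) 𝓘(ℝ, F) f x (mlieBracket 𝓘(ℝ, E) Z V x) = 0 := by
  set ψ := extChartAt 𝓘(ℝ, F) (f x) with hψ
  have hsrc : ∀ᶠ y in 𝓝 x, f y ∈ (chartAt F (f x)).source :=
    hf.continuous.continuousAt ((chartAt F (f x)).open_source.mem_nhds (mem_chart_source F (f x)))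
  have hfd (y : M) : MDiffAt f y := hf.mdifferentiable (by simp) y
  -- With `ψ` a chart of `N`, `V (ψ ∘ f)` vanishes and `Z (ψ ∘ f) = (W ψ) ∘ f` is annihilated by
  -- `V`. So the bracket kills `ψ ∘ f`, and the derivative of a chart is injective.
  have eV : (fun y ↦ mvfderiv 𝓘(ℝ, E) (ψ ∘ f) y (V y)) =ᶠ[𝓝 x] fun _ ↦ 0 := by
    filter_upwards [hsrc] with y hy
    rw [mvfderiv_extChartAt_comp (hfd y) hy, hV0, map_zero]
  have eZ : (fun y ↦ mvfderiv 𝓘(ℝ, E) (ψ ∘ f) y (Z y))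
      =ᶠ[𝓝 x] (fun z ↦ mvfderiv 𝓘(ℝ, F) ψ z (W z)) ∘ f := by
    filter_upwards [hsrc] with y hy
    rw [mvfderiv_extChartAt_comp (hfd y) hy, hZW]
    rfl
  have hdW : MDiffAt (fun z ↦ mvfderiv 𝓘(ℝ, F) ψ z (W z)) (f x) := by
    have h1 := contMDiffAt_mfderiv_apply
      (contMDiffAt_extChartAt (I := 𝓘(ℝ, F)) (n := ∞) (x := f x)) (hW (f x))
    have h2 := ((contMDiff_snd_tangentBundle_modelSpace F 𝓘(ℝ, F) (n := ∞)).contMDiffAt).comp _ h1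
    exact h2.mdifferentiableAt (by simp)
  have hψf : ContMDiffAt 𝓘(ℝ, E) 𝓘(ℝ, F) ∞ (ψ ∘ f) x :=
    (contMDiffAt_extChartAt (I := 𝓘(ℝ, F)) (n := ∞) (x := f x)).comp x (hf x)
  have hdf := hdW.comp x (hfd x)
  have key := mvfderiv_mlieBracket hψf hZ hV (hdf.congr_of_eventuallyEq eZ)
    ((mdifferentiableAt_const (c := (0 : F))).congr_of_eventuallyEq eV)
  have e1 : mvfderiv 𝓘(ℝ, E) (fun y ↦ mvfderiv 𝓘(ℝ, E) (ψ ∘ f) y (V y)) x = 0 := by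
    rw [mvfderiv, eV.mfderiv_eq, mfderiv_const]
    exact ContinuousLinearMap.comp_zero _
  have e2 : mvfderiv 𝓘(ℝ, E) (fun y ↦ mvfderiv 𝓘(ℝ, E) (ψ ∘ f) y (Z y)) x (V x) = 0 := by
    rw [mvfderiv, eZ.mfderiv_eq]
    change mfderiv _ _ _ x (V x) = 0
    rw [mfderiv_comp_apply x hdW (hfd x), hV0, map_zero]
  rw [e1, e2, zero_apply, sub_zero, mvfderiv_extChartAt_comp (hfd x) (mem_chart_source F (f x))]
    at key
  have hi := isInvertible_mfderiv_extChartAt (I := 𝓘(ℝ, F)) (mem_extChartAt_source (f x))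
  exact hi.injective (key.trans (map_zero _).symm)

end Bracket

/-- An orthogonal basis is normalised; positivity makes the square roots nonzero. -/
theorem exists_orthonormal_of_finrank_eq {V : Type*} [AddCommGroup V] [Module ℝ V]
    [FiniteDimensional ℝ V] (B : LinearMap.BilinForm ℝ V) (hs : ∀ u v, B u v = B v u)
    (hB : ∀ v, v ≠ 0 → 0 < B v v) {n : ℕ} (hn : Module.finrank ℝ V = n) :
    ∃ e : Fin n → V, ∀ a b, B (e a) (e b) = if a = b then 1 else 0 := by
  subst hn
  obtain ⟨v, hv⟩ := LinearMap.BilinForm.exists_orthogonal_basis (B := B) ⟨fun u v ↦ hs u v⟩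
  refine ⟨fun a ↦ (√(B (v a) (v a)))⁻¹ • v a, fun a b ↦ ?_⟩
  have hp := hB (v a) (v.ne_zero a)
  split_ifs with h
  · subst h
    simp only [map_smul, LinearMap.smul_apply, smul_eq_mul]
    rw [← mul_assoc, ← mul_inv, Real.mul_self_sqrt hp.le, inv_mul_cancel₀ hp.ne']
  · have : B (v a) (v b) = 0 := hv h
    simp [this]

/-! ### Vertical and basic fields of a Riemannian submersion -/

section Submersion

variable {E : Type*} [NormedAddCommGroup E] [NormedSpace ℝ E]
  {M : Type*} [TopologicalSpace M] [ChartedSpace E M]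
  {F : Type*} [NormedAddCommGroup F] [NormedSpace ℝ F]
  {N : Type*} [TopologicalSpace N] [ChartedSpace F N] {pi : M → N}

theorem mem_vertical_iff {x : M} {u : TangentSpace 𝓘(ℝ, E) x} :
    u ∈ vertical F pi x ↔ mfderiv 𝓘(ℝ, E) 𝓘(ℝ, F) pi x u = 0 := Iff.rfl

variable [IsManifold 𝓘(ℝ, E) ∞ M] {g : Metric E M}

theorem mem_horizontal_iff {x : M} {u : TangentSpace 𝓘(ℝ, E) x} :
    u ∈ horizontal F g pi x ↔ ∀ v ∈ vertical F pi x, g.inner x u v = 0 := by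
  refine forall₂_congr fun v _ ↦ ?_
  rw [g.symm x u v]
  rfl

variable [FiniteDimensional ℝ E]

theorem horizontalProj_mem (x : M) (u : TangentSpace 𝓘(ℝ, E) x) :
    horizontalProj F g pi x u ∈ horizontal F g pi x :=
  Submodule.projection_apply_mem _ _

theorem sub_horizontalProj_mem (x : M) (u : TangentSpace 𝓘(ℝ, E) x) :
    u - horizontalProj F g pi x u ∈ vertical F pi x := by
  rw [horizontalProj, ← Submodule.projection_eq_self_sub_projection]
  exact Submodule.projection_apply_mem _ _

theorem mfderiv_horizontalProj (x : M) (u : TangentSpace 𝓘(ℝ, E) x) :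
    mfderiv 𝓘(ℝ, E) 𝓘(ℝ, F) pi x (horizontalProj F g pi x u)
      = mfderiv 𝓘(ℝ, E) 𝓘(ℝ, F) pi x u := by
  have := mem_vertical_iff.1 (sub_horizontalProj_mem (g := g) (F := F) (pi := pi) x u)
  rw [map_sub, sub_eq_zero] at this
  exact this.symm

theorem inner_horizontalProj_left {x : M} {u w : TangentSpace 𝓘(ℝ, E) x}
    (hw : w ∈ horizontal F g pi x) :
    g.inner x (horizontalProj F g pi x u) w = g.inner x u w := by
  have := mem_horizontal_iff.1 hw _ (sub_horizontalProj_mem (F := F) (g := g) (pi := pi) x u)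
  rw [map_sub, sub_eq_zero] at this
  rw [g.symm x _ w, ← this, g.symm]

theorem eq_of_mem_horizontal {x : M} {u v : TangentSpace 𝓘(ℝ, E) x}
    (hu : u ∈ horizontal F g pi x) (hv : v ∈ horizontal F g pi x)
    (h : mfderiv 𝓘(ℝ, E) 𝓘(ℝ, F) pi x u = mfderiv 𝓘(ℝ, E) 𝓘(ℝ, F) pi x v) : u = v := by
  rw [← sub_eq_zero]
  refine Submodule.disjoint_def.1 (isCompl_horizontal_vertical F g pi x).disjoint _
    (sub_mem hu hv) ?_
  rw [mem_vertical_iff, map_sub, h, sub_self]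

variable [IsManifold 𝓘(ℝ, F) ∞ N] {gN : Metric F N}

namespace IsRiemannianSubmersion

/-- The vertical part of `v` contributes to neither side, so it is enough that one of the two
vectors is horizontal. -/
theorem inner_eq (hpi : IsRiemannianSubmersion g gN pi) {x : M} {u : TangentSpace 𝓘(ℝ, E) x}
    (hu : u ∈ horizontal F g pi x) (v : TangentSpace 𝓘(ℝ, E) x) :
    g.inner x u v = gN.inner (pi x) (mfderiv 𝓘(ℝ, E) 𝓘(ℝ, F) pi x u)
      (mfderiv 𝓘(ℝ, E) 𝓘(ℝ, F) pi x v) := by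
  have h1 := hpi.isometry x u hu _ (horizontalProj_mem (g := g) (F := F) (pi := pi) x v)
  rw [mfderiv_horizontalProj] at h1
  rw [← h1, g.symm x u, g.symm x u, inner_horizontalProj_left hu]

theorem exists_lift (hpi : IsRiemannianSubmersion g gN pi) (x : M)
    (z : TangentSpace 𝓘(ℝ, F) (pi x)) :
    ∃ u ∈ horizontal F g pi x, mfderiv 𝓘(ℝ, E) 𝓘(ℝ, F) pi x u = z := by
  obtain ⟨u, rfl⟩ := hpi.surjective x z
  exact ⟨_, horizontalProj_mem (g := g) x u, mfderiv_horizontalProj x u⟩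

/-- The inner product of a horizontal field with any field can be computed on `N`. This gives
smoothness of lifts and projections that are only defined pointwise. -/
theorem contMDiff_of_mem_horizontal (hpi : IsRiemannianSubmersion g gN pi)
    {Z : Π x : M, TangentSpace 𝓘(ℝ, E) x} (hZ : ∀ x, Z x ∈ horizontal F g pi x)
    (h : ContMDiff 𝓘(ℝ, E) 𝓘(ℝ, F).tangent ∞
      (fun x ↦ (⟨pi x, mfderiv 𝓘(ℝ, E) 𝓘(ℝ, F) pi x (Z x)⟩ : TangentBundle 𝓘(ℝ, F) N))) :
    ContMDiff 𝓘(ℝ, E) 𝓘(ℝ, E).tangent ∞ (fun x ↦ (⟨x, Z x⟩ : TangentBundle 𝓘(ℝ, E) M)) := by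
  intro x₀
  refine contMDiffAt_of_inner g fun w ↦ ?_
  have e : (fun x ↦ g.inner x (Z x) (extend E w x)) = fun x ↦ gN.inner (pi x)
      (mfderiv 𝓘(ℝ, E) 𝓘(ℝ, F) pi x (Z x)) (mfderiv 𝓘(ℝ, E) 𝓘(ℝ, F) pi x (extend E w x)) :=
    funext fun x ↦ hpi.inner_eq (hZ x) _
  rw [e]
  exact contMDiffAt_inner gN (h x₀)
    (contMDiffAt_mfderiv_apply (hpi.contMDiff x₀) (contMDiffAt_extend 𝓘(ℝ, E) E w))

theorem finrank_vertical (hpi : IsRiemannianSubmersion g gN pi) {n p : ℕ}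
    (hE : Module.finrank ℝ E = n + p) (hF : Module.finrank ℝ F = p) (x : M) :
    Module.finrank ℝ (vertical (E := E) F pi x) = n := by
  have h := LinearMap.finrank_range_add_finrank_ker
    (mfderiv 𝓘(ℝ, E) 𝓘(ℝ, F) pi x).toLinearMap
  have hr : LinearMap.range (mfderiv 𝓘(ℝ, E) 𝓘(ℝ, F) pi x).toLinearMap = ⊤ :=
    LinearMap.range_eq_top.2 (hpi.surjective x)
  rw [hr, finrank_top] at h
  have h1 : Module.finrank ℝ (TangentSpace 𝓘(ℝ, E) x) = n + p := hE
  have h2 : Module.finrank ℝ (TangentSpace 𝓘(ℝ, F) (pi x)) = p := hF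
  rw [h1, h2] at h
  unfold vertical
  omega

/-- The extension is the vertical part of an arbitrary smooth extension; its horizontal part is
smooth because it has the same image under `pi_*` as the whole field. -/
theorem exists_isVerticalField [T2Space M] (hpi : IsRiemannianSubmersion g gN pi) {x : M}
    {v : TangentSpace 𝓘(ℝ, E) x} (hv : v ∈ vertical F pi x) :
    ∃ X : Π x : M, TangentSpace 𝓘(ℝ, E) x, IsVerticalField F pi X ∧ X x = v := by
  obtain ⟨Y, hY, rfl⟩ := exists_contMDiff_field_eq v
  have hs : ContMDiff 𝓘(ℝ, E) 𝓘(ℝ, E).tangent ∞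
      (fun x ↦ (⟨x, horizontalProj F g pi x (Y x)⟩ : TangentBundle 𝓘(ℝ, E) M)) := by
    refine hpi.contMDiff_of_mem_horizontal (fun x ↦ horizontalProj_mem x _) ?_
    simp only [mfderiv_horizontalProj]
    exact fun x ↦ contMDiffAt_mfderiv_apply (hpi.contMDiff x) (hY x)
  refine ⟨fun x ↦ Y x - horizontalProj F g pi x (Y x),
    ⟨hY.sub_section hs, fun x ↦ sub_horizontalProj_mem x _⟩, ?_⟩
  have : horizontalProj F g pi x (Y x) = 0 := Submodule.projection_apply_of_mem_right _ hv
  simp [this]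

/-- Umbilicity is a condition on all frames orthonormal at the point; it can be put to use because
such a frame exists. -/
theorem exists_orthonormal_isVerticalField [T2Space M] (hpi : IsRiemannianSubmersion g gN pi)
    {n p : ℕ} (hE : Module.finrank ℝ E = n + p) (hF : Module.finrank ℝ F = p) (x : M) :
    ∃ e : Fin n → Π y : M, TangentSpace 𝓘(ℝ, E) y, (∀ a, IsVerticalField F pi (e a)) ∧
      ∀ a b, g.inner x (e a x) (e b x) = if a = b then 1 else 0 := by
  obtain ⟨v, hv⟩ := exists_orthonormal_of_finrank_eq
    ((bilin g x).restrict (vertical F pi x)) (fun u v ↦ g.symm x u v)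
    (fun v hv ↦ g.pos x v (by simpa using hv)) (hpi.finrank_vertical hE hF x)
  choose e he hev using fun a ↦ hpi.exists_isVerticalField (v a).2
  refine ⟨e, he, fun a b ↦ ?_⟩
  rw [hev, hev]
  exact hv a b

end IsRiemannianSubmersion

/-- The smooth vector field `Z` on `M` is horizontal and `pi`-related to `W`. -/
structure IsBasicField (g : Metric E M) (pi : M → N) (W : Π y : N, TangentSpace 𝓘(ℝ, F) y)
    (Z : Π x : M, TangentSpace 𝓘(ℝ, E) x) : Prop where
  contMDiff : ContMDiff 𝓘(ℝ, E) 𝓘(ℝ, E).tangent ∞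
    (fun x ↦ (⟨x, Z x⟩ : TangentBundle 𝓘(ℝ, E) M))
  mem_horizontal : ∀ x, Z x ∈ horizontal F g pi x
  mfderiv_eq : ∀ x, mfderiv 𝓘(ℝ, E) 𝓘(ℝ, F) pi x (Z x) = W (pi x)

theorem IsRiemannianSubmersion.exists_isBasicField (hpi : IsRiemannianSubmersion g gN pi)
    {W : Π y : N, TangentSpace 𝓘(ℝ, F) y}
    (hW : ContMDiff 𝓘(ℝ, F) 𝓘(ℝ, F).tangent ∞ (fun y ↦ (⟨y, W y⟩ : TangentBundle 𝓘(ℝ, F) N))) :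
    ∃ Z : Π x : M, TangentSpace 𝓘(ℝ, E) x, IsBasicField g pi W Z := by
  choose Z hZ hZW using fun x ↦ hpi.exists_lift x (W (pi x))
  refine ⟨Z, hpi.contMDiff_of_mem_horizontal hZ ?_, hZ, hZW⟩
  simp only [hZW]
  exact hW.comp hpi.contMDiff

/-- Every horizontal vector is a value of a basic field. -/
theorem IsRiemannianSubmersion.exists_isBasicField_eq [FiniteDimensional ℝ F] [T2Space N]
    (hpi : IsRiemannianSubmersion g gN pi) {x : M} {u : TangentSpace 𝓘(ℝ, E) x}
    (hu : u ∈ horizontal F g pi x) :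
    ∃ (W : Π y : N, TangentSpace 𝓘(ℝ, F) y) (Z : Π x : M, TangentSpace 𝓘(ℝ, E) x),
      ContMDiff 𝓘(ℝ, F) 𝓘(ℝ, F).tangent ∞ (fun y ↦ (⟨y, W y⟩ : TangentBundle 𝓘(ℝ, F) N)) ∧
      IsBasicField g pi W Z ∧ Z x = u := by
  obtain ⟨W, hW, hWx⟩ := exists_contMDiff_field_eq (mfderiv 𝓘(ℝ, E) 𝓘(ℝ, F) pi x u)
  obtain ⟨Z, hZ⟩ := hpi.exists_isBasicField hW
  exact ⟨W, Z, hW, hZ, eq_of_mem_horizontal (hZ.mem_horizontal x) hu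
    ((hZ.mfderiv_eq x).trans hWx)⟩

end Submersion

/-! ### The Lie derivative of the metric as a function of the field -/

section LieDerivative

variable {E : Type*} [NormedAddCommGroup E] [NormedSpace ℝ E] [CompleteSpace E]
  {M : Type*} [TopologicalSpace M] [ChartedSpace E M] [IsManifold 𝓘(ℝ, E) ∞ M]

theorem lieDerivMetric_add (g : Metric E M) {V V' X Y : Π x : M, TangentSpace 𝓘(ℝ, E) x} {x : M}
    (hV : MDiffAt (T% V) x) (hV' : MDiffAt (T% V') x) :
    lieDerivMetric g (V + V') X Y x = lieDerivMetric g V X Y x + lieDerivMetric g V' X Y x := by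
  simp only [lieDerivMetric, mlieBracket_add_left hV hV', Pi.add_apply, map_add, add_apply]
  ring

/-- In `[f V, X] = f [V, X] - (X f) V` the last term vanishes, which makes the Lie derivative linear
over functions constant along the fibers. -/
theorem lieDerivMetric_smul (g : Metric E M) {f : M → ℝ}
    {V X Y : Π x : M, TangentSpace 𝓘(ℝ, E) x} {x : M} (hf : MDiffAt f x) (hV : MDiffAt (T% V) x)
    (hX : mvfderiv 𝓘(ℝ, E) f x (X x) = 0) (hY : mvfderiv 𝓘(ℝ, E) f x (Y x) = 0) :
    lieDerivMetric g (f • V) X Y x = f x * lieDerivMetric g V X Y x := by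
  simp only [lieDerivMetric, mlieBracket_smul_left hf hV, Pi.smul_apply', map_smul, map_add,
    smul_apply, add_apply, smul_eq_mul, hX, hY, neg_zero, zero_smul, map_zero, zero_apply]
  ring

end LieDerivative

/-! ### Umbilicity in terms of Lie derivatives along basic fields -/

section Umbilical

variable {E : Type*} [NormedAddCommGroup E] [NormedSpace ℝ E]
  {M : Type*} [TopologicalSpace M] [ChartedSpace E M] [IsManifold 𝓘(ℝ, E) ∞ M]
  {F : Type*} [NormedAddCommGroup F] [NormedSpace ℝ F]
  {N : Type*} [TopologicalSpace N] [ChartedSpace F N] {g g' : Metric E M} {pi : M → N}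

theorem IsVerticalField.mdifferentiableAt {X : Π x : M, TangentSpace 𝓘(ℝ, E) x}
    (hX : IsVerticalField F pi X) (x : M) : MDiffAt (T% X) x :=
  hX.contMDiff.mdifferentiable (by simp) x

theorem IsBasicField.mdifferentiableAt {W : Π y : N, TangentSpace 𝓘(ℝ, F) y}
    {Z : Π x : M, TangentSpace 𝓘(ℝ, E) x} (hZ : IsBasicField g pi W Z) (x : M) :
    MDiffAt (T% Z) x :=
  hZ.contMDiff.mdifferentiable (by simp) x

variable [FiniteDimensional ℝ E] [IsManifold 𝓘(ℝ, F) ∞ N] {gN : Metric F N}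

theorem IsVerticalField.mlieBracket_mem_vertical (hpi : ContMDiff 𝓘(ℝ, E) 𝓘(ℝ, F) ∞ pi)
    {X Y : Π x : M, TangentSpace 𝓘(ℝ, E) x} (hX : IsVerticalField F pi X)
    (hY : IsVerticalField F pi Y) (x : M) :
    mlieBracket 𝓘(ℝ, E) X Y x ∈ vertical F pi x :=
  mfderiv_mlieBracket_eq_zero hpi (hY.mdifferentiableAt x) (hX.mdifferentiableAt x)
    (contMDiff_zeroSection ℝ (TangentSpace 𝓘(ℝ, F) : N → Type _)) hY.mem_vertical hX.mem_vertical

theorem IsBasicField.mlieBracket_mem_vertical (hpi : ContMDiff 𝓘(ℝ, E) 𝓘(ℝ, F) ∞ pi)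
    {W : Π y : N, TangentSpace 𝓘(ℝ, F) y}
    (hW : ContMDiff 𝓘(ℝ, F) 𝓘(ℝ, F).tangent ∞ (fun y ↦ (⟨y, W y⟩ : TangentBundle 𝓘(ℝ, F) N)))
    {Z X : Π x : M, TangentSpace 𝓘(ℝ, E) x} (hZ : IsBasicField g pi W Z)
    (hX : IsVerticalField F pi X) (x : M) :
    mlieBracket 𝓘(ℝ, E) Z X x ∈ vertical F pi x :=
  mfderiv_mlieBracket_eq_zero hpi (hX.mdifferentiableAt x) (hZ.mdifferentiableAt x) hW
    hX.mem_vertical hZ.mfderiv_eq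

/-- For a basic field `Z`, the Lie derivative of the metric along `Z` on vertical fields depends
only on the metric of the fibers. -/
theorem IsBasicField.lieDerivMetric_congr (hpi : ContMDiff 𝓘(ℝ, E) 𝓘(ℝ, F) ∞ pi)
    {g₁ : Metric E M} {W : Π y : N, TangentSpace 𝓘(ℝ, F) y}
    (hW : ContMDiff 𝓘(ℝ, F) 𝓘(ℝ, F).tangent ∞ (fun y ↦ (⟨y, W y⟩ : TangentBundle 𝓘(ℝ, F) N)))
    {Z X Y : Π x : M, TangentSpace 𝓘(ℝ, E) x} (hZ : IsBasicField g₁ pi W Z)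
    (hX : IsVerticalField F pi X) (hY : IsVerticalField F pi Y)
    (h : ∀ x, ∀ u ∈ vertical F pi x, ∀ v ∈ vertical F pi x, g.inner x u v = g'.inner x u v)
    (x : M) : lieDerivMetric g Z X Y x = lieDerivMetric g' Z X Y x := by
  -- The brackets of `Z` with vertical fields are vertical, so every inner product involved is one
  -- of vertical vectors.
  simp only [lieDerivMetric, h _ _ (hX.mem_vertical _) _ (hY.mem_vertical _),
    h _ _ (hZ.mlieBracket_mem_vertical hpi hW hX _) _ (hY.mem_vertical _),
    h _ _ (hX.mem_vertical _) _ (hZ.mlieBracket_mem_vertical hpi hW hY _)]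

/-- `g (h (X, Y), Z) = - (1 / 2) (L_Z g) (X, Y)` for vertical `X`, `Y` and basic `Z`. -/
theorem inner_secondFundamentalForm (hpi : ContMDiff 𝓘(ℝ, E) 𝓘(ℝ, F) ∞ pi)
    {W : Π y : N, TangentSpace 𝓘(ℝ, F) y} {Z X Y : Π x : M, TangentSpace 𝓘(ℝ, E) x}
    (hZ : IsBasicField g pi W Z) (hX : IsVerticalField F pi X) (hY : IsVerticalField F pi Y)
    (x : M) :
    g.inner x (secondFundamentalForm F g pi X Y x) (Z x) = -(lieDerivMetric g Z X Y x / 2) := by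
  rw [secondFundamentalForm, inner_horizontalProj_left (hZ.mem_horizontal x)]
  obtain ⟨htor, hmet⟩ : IsLeviCivita g (leviCivita g) := (exists_isLeviCivita g).choose_spec
  rw [CovariantDerivative.torsion_eq_zero_iff] at htor
  have dX := hX.mdifferentiableAt x
  have dY := hY.mdifferentiableAt x
  have dZ := hZ.mdifferentiableAt x
  have t1 := htor dX dY
  have t2 := htor dZ dX
  have t3 := htor dZ dY
  have m1 := hmet x (X x) Y Z dY dZ
  have m2 := hmet x (Y x) X Z dX dZ
  have m3 := hmet x (Z x) X Y dX dY
  have z (U : Π x : M, TangentSpace 𝓘(ℝ, E) x) (hU : IsVerticalField F pi U) :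
      (fun y ↦ g.inner y (U y) (Z y)) = fun _ ↦ 0 := by
    ext y
    rw [g.symm]
    exact mem_horizontal_iff.1 (hZ.mem_horizontal y) _ (hU.mem_vertical y)
  rw [z Y hY, mvfderiv_const, zero_apply] at m1
  rw [z X hX, mvfderiv_const, zero_apply] at m2
  -- Since `[X, Y]` is vertical, `g (∇_X Y, Z) = g (∇_Y X, Z)`. Hence the two terms of `(L_Z g) (X,
  -- Y) = g (∇_X Z, Y) + g (X, ∇_Y Z)` both equal `-g (∇_X Y, Z)`.
  have b := mem_horizontal_iff.1 (hZ.mem_horizontal x) _ (hX.mlieBracket_mem_vertical hpi hY x)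
  rw [← t1, map_sub, g.symm x (Z x), g.symm x (Z x)] at b
  rw [lieDerivMetric, m3, ← t2, ← t3]
  simp only [map_sub, sub_apply]
  rw [g.symm x _ (Y x)] at *
  linarith [g.symm x (leviCivita g Z x (X x)) (Y x), g.symm x (leviCivita g X x (Z x)) (Y x)]

theorem HasTotallyUmbilicalFibers.exists_lieDerivMetric_eq [T2Space M] {n p : ℕ}
    (hE : Module.finrank ℝ E = n + p) (hF : Module.finrank ℝ F = p)
    (hpi : IsRiemannianSubmersion g gN pi) (hg : HasTotallyUmbilicalFibers F n g pi)
    {W : Π y : N, TangentSpace 𝓘(ℝ, F) y} {Z : Π x : M, TangentSpace 𝓘(ℝ, E) x}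
    (hZ : IsBasicField g pi W Z) (x : M) :
    ∃ c : ℝ, ∀ X Y : Π x : M, TangentSpace 𝓘(ℝ, E) x, IsVerticalField F pi X →
      IsVerticalField F pi Y → lieDerivMetric g Z X Y x = c * g.inner x (X x) (Y x) := by
  obtain ⟨e, he, heo⟩ := hpi.exists_orthonormal_isVerticalField hE hF x
  refine ⟨-2 * (1 / (n : ℝ) * g.inner x (∑ a, secondFundamentalForm F g pi (e a) (e a) x) (Z x)),
    fun X Y hX hY ↦ ?_⟩
  have h1 := inner_secondFundamentalForm hpi.contMDiff hZ hX hY x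
  rw [hg x e he heo X Y hX hY, map_smul, smul_apply, smul_eq_mul] at h1
  linarith

/-- The defect of umbilicity at a point is horizontal, hence the value of a basic field `Z`. Its
product with `Z` involves only the factor `c`, which cancels on taking the trace over the frame. -/
theorem hasTotallyUmbilicalFibers_of_lieDerivMetric_eq [FiniteDimensional ℝ F] [T2Space N]
    {n p : ℕ} (hE : Module.finrank ℝ E = n + p) (hF : Module.finrank ℝ F = p)
    (hpi : IsRiemannianSubmersion g gN pi)
    (h : ∀ (W : Π y : N, TangentSpace 𝓘(ℝ, F) y) (Z : Π x : M, TangentSpace 𝓘(ℝ, E) x),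
      ContMDiff 𝓘(ℝ, F) 𝓘(ℝ, F).tangent ∞ (fun y ↦ (⟨y, W y⟩ : TangentBundle 𝓘(ℝ, F) N)) →
      IsBasicField g pi W Z → ∀ x, ∃ c : ℝ, ∀ X Y : Π x : M, TangentSpace 𝓘(ℝ, E) x,
        IsVerticalField F pi X → IsVerticalField F pi Y →
        lieDerivMetric g Z X Y x = c * g.inner x (X x) (Y x)) :
    HasTotallyUmbilicalFibers F n g pi := by
  intro x e he heo X Y hX hY
  have hmem (X Y : Π x : M, TangentSpace 𝓘(ℝ, E) x) :
      secondFundamentalForm F g pi X Y x ∈ horizontal F g pi x := horizontalProj_mem x _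
  rw [← sub_eq_zero]
  set δ := secondFundamentalForm F g pi X Y x - ((1 / (n : ℝ)) * g.inner x (X x) (Y x)) •
    ∑ a, secondFundamentalForm F g pi (e a) (e a) x with hδ
  have hδm : δ ∈ horizontal F g pi x :=
    sub_mem (hmem _ _) (Submodule.smul_mem _ _ (Submodule.sum_mem _ fun a _ ↦ hmem _ _))
  obtain ⟨W, Z, hW, hZ, hZx⟩ := hpi.exists_isBasicField_eq hδm
  obtain ⟨c, hc⟩ := h W Z hW hZ x
  refine eq_zero_of_bilin_self g ?_
  change g.inner x δ δ = 0
  nth_rw 2 [← hZx]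
  rw [hδ, map_sub, sub_apply, map_smul, smul_apply, map_sum, sum_apply,
    inner_secondFundamentalForm hpi.contMDiff hZ hX hY, hc X Y hX hY]
  have hs (a : Fin n) : g.inner x (secondFundamentalForm F g pi (e a) (e a) x) (Z x)
      = -(c / 2) := by
    rw [inner_secondFundamentalForm hpi.contMDiff hZ (he a) (he a), hc _ _ (he a) (he a), heo]
    simp
  simp only [hs, Finset.sum_const, Finset.card_univ, Fintype.card_fin, nsmul_eq_mul, smul_eq_mul]
  -- For `n = 0` the factor `1 / n` is `0` by convention, but the vertical spaces vanish too.
  rcases Nat.eq_zero_or_pos n with rfl | hn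
  · have h0 : vertical F pi x = (⊥ : Submodule ℝ (TangentSpace 𝓘(ℝ, E) x)) :=
      Submodule.finrank_eq_zero.1 (hpi.finrank_vertical hE hF x)
    have hX0 : X x = 0 := by simpa [h0] using hX.mem_vertical x
    simp [hX0]
  · have : (n : ℝ) ≠ 0 := by positivity
    field_simp
    ring

end Umbilical

/-! ### From a variation to a conformal Killing field -/

section Conformal

variable {E : Type*} [NormedAddCommGroup E] [NormedSpace ℝ E]
  {M : Type*} [TopologicalSpace M] [ChartedSpace E M] [IsManifold 𝓘(ℝ, E) ∞ M]
  {F : Type*} [NormedAddCommGroup F] [NormedSpace ℝ F]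
  {N : Type*} [TopologicalSpace N] [ChartedSpace F N] {g g' : Metric E M} {pi : M → N}

theorem metric_ext (h : ∀ x u v, g.inner x u v = g'.inner x u v) : g = g' := by
  have : g.inner = g'.inner := by
    ext x u v
    exact h x u v
  cases g
  cases g'
  congr

theorem isConformalKillingOnFiber_of_forall {ξ : Π x : M, TangentSpace 𝓘(ℝ, E) x}
    (h : ∀ x, ∃ c : ℝ, ∀ X Y : Π x : M, TangentSpace 𝓘(ℝ, E) x, IsVerticalField F pi X →
      IsVerticalField F pi Y → lieDerivMetric g ξ X Y x = c * g.inner x (X x) (Y x)) (b : N) :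
    IsConformalKillingOnFiber F g pi ξ b := by
  choose c hc using h
  exact ⟨fun x ↦ c x, fun X Y hX hY x ↦ hc x X Y hX hY⟩

theorem IsConformalKillingOnFiber.exists_lieDerivMetric_eq
    {ξ : Π x : M, TangentSpace 𝓘(ℝ, E) x} (h : ∀ b, IsConformalKillingOnFiber F g pi ξ b) (x : M) :
    ∃ c : ℝ, ∀ X Y : Π x : M, TangentSpace 𝓘(ℝ, E) x, IsVerticalField F pi X →
      IsVerticalField F pi Y → lieDerivMetric g ξ X Y x = c * g.inner x (X x) (Y x) := by
  obtain ⟨f, hf⟩ := h (pi x)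
  exact ⟨f ⟨x, rfl⟩, fun X Y hX hY ↦ hf X Y hX hY ⟨x, rfl⟩⟩

variable [FiniteDimensional ℝ E] [IsManifold 𝓘(ℝ, F) ∞ N] {gN : Metric F N}

/-- A submersion metric is determined by the metric of the fibers and the horizontal spaces. -/
theorem IsRiemannianSubmersion.eq_of_horizontal_le (hpi : IsRiemannianSubmersion g gN pi)
    (hpi' : IsRiemannianSubmersion g' gN pi)
    (hv : ∀ x, ∀ u ∈ vertical F pi x, ∀ v ∈ vertical F pi x, g.inner x u v = g'.inner x u v)
    (hh : ∀ x, horizontal F g pi x ≤ horizontal F g' pi x) : g = g' := by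
  refine metric_ext fun x u w ↦ ?_
  have hmem (u : TangentSpace 𝓘(ℝ, E) x) : horizontalProj F g pi x u ∈ horizontal F g pi x :=
    horizontalProj_mem x u
  have key (u w : TangentSpace 𝓘(ℝ, E) x) : g.inner x (horizontalProj F g pi x u) w
      = g'.inner x (horizontalProj F g pi x u) w := by
    rw [hpi.inner_eq (hmem u), hpi'.inner_eq (hh x (hmem u))]
  -- With `P` the `g`-horizontal projection, `g (u, w)` is the sum of `g (P u, w)`, `g (u - P u, P
  -- w)` and `g (u - P u, w - P w)`. The first two are given by `gN`, the last by the fiber metric.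
  have hk := key w (u - horizontalProj F g pi x u)
  have hk' := key u w
  have hvv := hv x _ (sub_horizontalProj_mem (g := g) (F := F) (pi := pi) x u) _
    (sub_horizontalProj_mem (g := g) (F := F) (pi := pi) x w)
  rw [g.symm, g'.symm] at hk
  rw [map_sub (g.inner x _), map_sub (g'.inner x _), hk, sub_left_inj] at hvv
  simpa [hk'] using hvv

theorem IsRiemannianSubmersion.exists_conformalKilling [FiniteDimensional ℝ F] [T2Space M]
    [T2Space N] {n p : ℕ} (hE : Module.finrank ℝ E = n + p) (hF : Module.finrank ℝ F = p)
    (hpi : IsRiemannianSubmersion g gN pi) (hpi' : IsRiemannianSubmersion g' gN pi)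
    (hg : HasTotallyUmbilicalFibers F n g pi) (hg' : HasTotallyUmbilicalFibers F n g' pi)
    (hv : ∀ x, ∀ u ∈ vertical F pi x, ∀ v ∈ vertical F pi x, g'.inner x u v = g.inner x u v)
    (hne : g' ≠ g) :
    ∃ ξ : Π x : M, TangentSpace 𝓘(ℝ, E) x, IsVerticalField F pi ξ ∧ (∃ x, ξ x ≠ 0) ∧
      ∀ b : N, IsConformalKillingOnFiber F g pi ξ b := by
  have : ∃ x, ∃ u ∈ horizontal F g' pi x, u ∉ horizontal F g pi x := by
    by_contra! h
    exact hne (hpi'.eq_of_horizontal_le hpi hv h)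
  obtain ⟨x, u, hu, hu'⟩ := this
  obtain ⟨W, Z', hW, hZ', rfl⟩ := hpi'.exists_isBasicField_eq hu
  obtain ⟨Z, hZ⟩ := hpi.exists_isBasicField hW
  have hξ : IsVerticalField F pi (Z' - Z) := by
    refine ⟨hZ'.contMDiff.sub_section hZ.contMDiff, fun y ↦ ?_⟩
    rw [mem_vertical_iff, Pi.sub_apply, map_sub, hZ'.mfderiv_eq, hZ.mfderiv_eq, sub_self]
  refine ⟨Z' - Z, hξ, ⟨x, fun h0 ↦ hu' ?_⟩, isConformalKillingOnFiber_of_forall fun y ↦ ?_⟩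
  -- The field `Z'` was chosen to pass through a vector that is not `g`-horizontal, whereas `Z` is
  -- `g`-horizontal.
  · rw [sub_eq_zero.1 h0]
    exact hZ.mem_horizontal x
  · obtain ⟨c, hc⟩ := hg.exists_lieDerivMetric_eq hE hF hpi hZ y
    obtain ⟨c', hc'⟩ := hg'.exists_lieDerivMetric_eq hE hF hpi' hZ' y
    refine ⟨c' - c, fun X Y hX hY ↦ ?_⟩
    -- In `L_{Z'} g = L_ξ g + L_Z g` the left side may be computed with `g'`, for which `Z'` is
    -- basic.
    have h1 := lieDerivMetric_add g (X := X) (Y := Y) (hξ.mdifferentiableAt y)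
      (hZ.mdifferentiableAt y)
    rw [sub_add_cancel, ← hZ'.lieDerivMetric_congr hpi.contMDiff hW hX hY hv, hc' X Y hX hY,
      hc X Y hX hY, hv _ _ (hX.mem_vertical y) _ (hY.mem_vertical y)] at h1
    linarith

end Conformal

/-! ### Shearing a metric -/

section Shear

variable {E : Type*} [NormedAddCommGroup E] [NormedSpace ℝ E]
  {M : Type*} [TopologicalSpace M] [ChartedSpace E M] [IsManifold 𝓘(ℝ, E) ∞ M]

/-- The endomorphism `u ↦ u - s g (B, u) ξ` of the tangent space at `x`. -/
def shearMap (g : Metric E M) (B ξ : Π x : M, TangentSpace 𝓘(ℝ, E) x) (s : ℝ) (x : M) :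
    TangentSpace 𝓘(ℝ, E) x →L[ℝ] TangentSpace 𝓘(ℝ, E) x :=
  ContinuousLinearMap.id ℝ _ - s • (g.inner x (B x)).smulRight (ξ x)

theorem shearMap_apply (g : Metric E M) (B ξ : Π x : M, TangentSpace 𝓘(ℝ, E) x) (s : ℝ) (x : M)
    (u : TangentSpace 𝓘(ℝ, E) x) :
    shearMap g B ξ s x u = u - (s * g.inner x (B x) u) • ξ x := by
  simp [shearMap, mul_smul]

/-- The map `u ↦ g (B, u) ξ` squares to zero. So the shear is invertible for every `s`, and the
pulled back form is positive definite. -/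
theorem shearMap_neg_shearMap (g : Metric E M) {B ξ : Π x : M, TangentSpace 𝓘(ℝ, E) x} {x : M}
    (h : g.inner x (B x) (ξ x) = 0) (s : ℝ) (u : TangentSpace 𝓘(ℝ, E) x) :
    shearMap g B ξ (-s) x (shearMap g B ξ s x u) = u := by
  simp [shearMap_apply, h]

/-- The pullback of `g` under `shearMap g B ξ s x`. -/
def shearInner (g : Metric E M) (B ξ : Π x : M, TangentSpace 𝓘(ℝ, E) x) (s : ℝ) (x : M) :
    TangentSpace 𝓘(ℝ, E) x →L[ℝ] TangentSpace 𝓘(ℝ, E) x →L[ℝ] ℝ :=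
  g.inner x - s • ((g.inner x (B x)).smulRight (g.inner x (ξ x))
      + (g.inner x (ξ x)).smulRight (g.inner x (B x)))
    + (s ^ 2 * g.inner x (ξ x) (ξ x)) • (g.inner x (B x)).smulRight (g.inner x (B x))

/-- The expanded form shows smoothness jointly in `s` and `x`; the pullback form shows symmetry and
positivity. -/
theorem shearInner_apply (g : Metric E M) (B ξ : Π x : M, TangentSpace 𝓘(ℝ, E) x) (s : ℝ) (x : M)
    (u v : TangentSpace 𝓘(ℝ, E) x) :
    shearInner g B ξ s x u v = g.inner x (shearMap g B ξ s x u) (shearMap g B ξ s x v) := by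
  change g.inner x u v - s * (g.inner x (B x) u * g.inner x (ξ x) v
      + g.inner x (ξ x) u * g.inner x (B x) v)
    + (s ^ 2 * g.inner x (ξ x) (ξ x)) * (g.inner x (B x) u * g.inner x (B x) v) = _
  simp only [shearMap_apply, map_sub, map_smul, sub_apply, smul_apply, smul_eq_mul,
    g.symm x u (ξ x)]
  ring

variable [FiniteDimensional ℝ E]

theorem contMDiff_shearInner (g : Metric E M) {B ξ : Π x : M, TangentSpace 𝓘(ℝ, E) x}
    (hB : ContMDiff 𝓘(ℝ, E) 𝓘(ℝ, E).tangent ∞ (fun x ↦ (⟨x, B x⟩ : TangentBundle 𝓘(ℝ, E) M)))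
    (hξ : ContMDiff 𝓘(ℝ, E) 𝓘(ℝ, E).tangent ∞ (fun x ↦ (⟨x, ξ x⟩ : TangentBundle 𝓘(ℝ, E) M))) :
    ContMDiff (𝓘(ℝ, ℝ).prod 𝓘(ℝ, E)) (𝓘(ℝ, E).prod 𝓘(ℝ, E →L[ℝ] E →L[ℝ] ℝ)) ∞
      (fun q : ℝ × M ↦ TotalSpace.mk' (E →L[ℝ] E →L[ℝ] ℝ)
        (E := fun x : M ↦ TangentSpace 𝓘(ℝ, E) x →L[ℝ] TangentSpace 𝓘(ℝ, E) x →L[ℝ] ℝ)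
        q.2 (shearInner g B ξ q.1 q.2)) := by
  intro q₀
  have hsnd : ContMDiffAt (𝓘(ℝ, ℝ).prod 𝓘(ℝ, E)) 𝓘(ℝ, E) ∞ (Prod.snd : ℝ × M → M) q₀ :=
    contMDiffAt_snd
  have hB' := (hB q₀.2).comp q₀ hsnd
  have hξ' := (hξ q₀.2).comp q₀ hsnd
  refine contMDiffWithinAt_hom_of_extend (s := Set.univ) (F₁ := E) (F₂ := E →L[ℝ] ℝ)
    (E₁ := (TangentSpace 𝓘(ℝ, E) : M → Type _))
    (E₂ := fun x : M ↦ TangentSpace 𝓘(ℝ, E) x →L[ℝ] ℝ) (Set.mem_univ _) hsnd fun u ↦ ?_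
  refine contMDiffWithinAt_hom_of_extend (s := Set.univ) (F₁ := E) (F₂ := ℝ)
    (E₁ := (TangentSpace 𝓘(ℝ, E) : M → Type _))
    (E₂ := Bundle.Trivial M ℝ) (Set.mem_univ _) hsnd fun v ↦ ?_
  refine (contMDiffWithinAt_totalSpace (F := ℝ) (E := Bundle.Trivial M ℝ)).2 ⟨hsnd, ?_⟩
  have hu := (contMDiffAt_extend (k := ∞) 𝓘(ℝ, E) E u).comp q₀ hsnd
  have hv := (contMDiffAt_extend (k := ∞) 𝓘(ℝ, E) E v).comp q₀ hsnd
  have hs : ContMDiffAt (𝓘(ℝ, ℝ).prod 𝓘(ℝ, E)) 𝓘(ℝ) ∞ (Prod.fst : ℝ × M → ℝ) q₀ :=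
    contMDiffAt_fst
  have hBu := contMDiffAt_inner g hB' hu
  have hBv := contMDiffAt_inner g hB' hv
  have hξu := contMDiffAt_inner g hξ' hu
  have hξv := contMDiffAt_inner g hξ' hv
  have hξξ := contMDiffAt_inner g hξ' hξ'
  have huv := contMDiffAt_inner g hu hv
  exact (huv.sub (hs.mul ((hBu.mul hξv).add (hξu.mul hBv)))).add
    (((hs.pow 2).mul hξξ).mul (hBu.mul hBv))

/-- The pullback of the metric `g` under the bundle automorphism `u ↦ u - s g (B, u) ξ`. -/
def shear (g : Metric E M) {B ξ : Π x : M, TangentSpace 𝓘(ℝ, E) x}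
    (hB : ContMDiff 𝓘(ℝ, E) 𝓘(ℝ, E).tangent ∞ (fun x ↦ (⟨x, B x⟩ : TangentBundle 𝓘(ℝ, E) M)))
    (hξ : ContMDiff 𝓘(ℝ, E) 𝓘(ℝ, E).tangent ∞ (fun x ↦ (⟨x, ξ x⟩ : TangentBundle 𝓘(ℝ, E) M)))
    (h : ∀ x, g.inner x (B x) (ξ x) = 0) (s : ℝ) : Metric E M where
  inner := shearInner g B ξ s
  symm x u v := by rw [shearInner_apply, shearInner_apply, g.symm]
  pos x u hu := by
    rw [shearInner_apply]
    refine g.pos x _ fun h0 ↦ hu ?_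
    rw [← shearMap_neg_shearMap g (h x) s u, h0, map_zero]
  isVonNBounded x := by
    -- The unit ball of the new metric lies in the image of the old one under the inverse shear.
    refine ((g.isVonNBounded x).image (shearMap g B ξ (-s) x)).subset fun u hu ↦ ?_
    refine ⟨shearMap g B ξ s x u, ?_, shearMap_neg_shearMap g (h x) s u⟩
    rw [Set.mem_ofPred_eq, shearInner_apply] at hu
    exact hu
  contMDiff := (contMDiff_shearInner g hB hξ).comp (contMDiff_const.prodMk contMDiff_id)

end Shear

/-! ### From a conformal Killing field to a variation -/

section Variation

variable {E : Type*} [NormedAddCommGroup E] [NormedSpace ℝ E]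
  {M : Type*} [TopologicalSpace M] [ChartedSpace E M] [IsManifold 𝓘(ℝ, E) ∞ M]
  {F : Type*} [NormedAddCommGroup F] [NormedSpace ℝ F]
  {N : Type*} [TopologicalSpace N] [ChartedSpace F N]
  {g : Metric E M} {pi : M → N} {W : Π y : N, TangentSpace 𝓘(ℝ, F) y}
  {B ξ : Π x : M, TangentSpace 𝓘(ℝ, E) x}

theorem shearMap_of_mem_vertical {x : M} (hB : B x ∈ horizontal F g pi x) (s : ℝ)
    {u : TangentSpace 𝓘(ℝ, E) x} (hu : u ∈ vertical F pi x) : shearMap g B ξ s x u = u := by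
  rw [shearMap_apply, mem_horizontal_iff.1 hB u hu]
  simp

theorem mfderiv_shearMap (hξ : IsVerticalField F pi ξ) (s : ℝ) (x : M)
    (u : TangentSpace 𝓘(ℝ, E) x) :
    mfderiv 𝓘(ℝ, E) 𝓘(ℝ, F) pi x (shearMap g B ξ s x u) = mfderiv 𝓘(ℝ, E) 𝓘(ℝ, F) pi x u := by
  rw [shearMap_apply, map_sub, map_smul, mem_vertical_iff.1 (hξ.mem_vertical x), smul_zero, sub_zero]

theorem IsBasicField.inner_eq_zero (hB : IsBasicField g pi W B) (hξ : IsVerticalField F pi ξ)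
    (x : M) : g.inner x (B x) (ξ x) = 0 :=
  mem_horizontal_iff.1 (hB.mem_horizontal x) _ (hξ.mem_vertical x)

variable [FiniteDimensional ℝ E]

theorem shear_inner_apply
    (hB : ContMDiff 𝓘(ℝ, E) 𝓘(ℝ, E).tangent ∞ (fun x ↦ (⟨x, B x⟩ : TangentBundle 𝓘(ℝ, E) M)))
    (hξ : ContMDiff 𝓘(ℝ, E) 𝓘(ℝ, E).tangent ∞ (fun x ↦ (⟨x, ξ x⟩ : TangentBundle 𝓘(ℝ, E) M)))
    (h : ∀ x, g.inner x (B x) (ξ x) = 0) (s : ℝ) (x : M) (u v : TangentSpace 𝓘(ℝ, E) x) :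
    (shear g hB hξ h s).inner x u v
      = g.inner x (shearMap g B ξ s x u) (shearMap g B ξ s x v) :=
  shearInner_apply g B ξ s x u v

/-- The shear of `g` along a vertical field and a basic field. -/
abbrev IsBasicField.shear (hB : IsBasicField g pi W B) (hξ : IsVerticalField F pi ξ) (s : ℝ) :
    Metric E M :=
  RiemSub.shear g hB.contMDiff hξ.contMDiff (hB.inner_eq_zero hξ) s

theorem IsBasicField.shear_inner_of_mem_vertical (hB : IsBasicField g pi W B)
    (hξ : IsVerticalField F pi ξ) (s : ℝ) (x : M) (u : TangentSpace 𝓘(ℝ, E) x)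
    (hu : u ∈ vertical F pi x) (v : TangentSpace 𝓘(ℝ, E) x) (hv : v ∈ vertical F pi x) :
    (hB.shear hξ s).inner x u v = g.inner x u v := by
  rw [shear_inner_apply, shearMap_of_mem_vertical (hB.mem_horizontal x) s hu,
    shearMap_of_mem_vertical (hB.mem_horizontal x) s hv]

/-- The shear is an isometry from the new metric to `g` and fixes vertical vectors, so it respects
orthogonality to them. -/
theorem IsBasicField.shearMap_mem_horizontal (hB : IsBasicField g pi W B)
    (hξ : IsVerticalField F pi ξ) {s : ℝ} {x : M} {u : TangentSpace 𝓘(ℝ, E) x}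
    (hu : u ∈ horizontal F (hB.shear hξ s) pi x) :
    shearMap g B ξ s x u ∈ horizontal F g pi x := by
  rw [mem_horizontal_iff] at hu ⊢
  intro v hv
  rw [← hu v hv, shear_inner_apply, shearMap_of_mem_vertical (hB.mem_horizontal x) s hv]

theorem IsBasicField.isVariation_shear (hB : IsBasicField g pi W B) (hξ : IsVerticalField F pi ξ) :
    IsVariation g (vertical F pi) 1 (hB.shear hξ) where
  pos := one_pos
  zero := metric_ext fun x u v ↦ by simp [shear_inner_apply, shearMap_apply]
  contMDiffOn := (contMDiff_shearInner g hB.contMDiff hξ.contMDiff).contMDiffOn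
  eq_on t _ := hB.shear_inner_of_mem_vertical hξ t

variable [IsManifold 𝓘(ℝ, F) ∞ N] {gN : Metric F N}

theorem IsRiemannianSubmersion.shear (hpi : IsRiemannianSubmersion g gN pi)
    (hB : IsBasicField g pi W B) (hξ : IsVerticalField F pi ξ) (s : ℝ) :
    IsRiemannianSubmersion (hB.shear hξ s) gN pi where
  contMDiff := hpi.contMDiff
  surjective := hpi.surjective
  isometry x u hu v hv := by
    rw [shear_inner_apply, hpi.isometry x _ (hB.shearMap_mem_horizontal hξ hu) _
      (hB.shearMap_mem_horizontal hξ hv), mfderiv_shearMap hξ, mfderiv_shearMap hξ]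

theorem hasTotallyUmbilicalFibers_shear [FiniteDimensional ℝ F] [T2Space M] [T2Space N] {n p : ℕ}
    (hE : Module.finrank ℝ E = n + p) (hF : Module.finrank ℝ F = p)
    (hpi : IsRiemannianSubmersion g gN pi) (hg : HasTotallyUmbilicalFibers F n g pi)
    (hW : ContMDiff 𝓘(ℝ, F) 𝓘(ℝ, F).tangent ∞ (fun y ↦ (⟨y, W y⟩ : TangentBundle 𝓘(ℝ, F) N)))
    (hB : IsBasicField g pi W B) (hξ : IsVerticalField F pi ξ)
    (hc : ∀ b : N, IsConformalKillingOnFiber F g pi ξ b) (s : ℝ) :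
    HasTotallyUmbilicalFibers F n (hB.shear hξ s) pi := by
  refine hasTotallyUmbilicalFibers_of_lieDerivMetric_eq hE hF (hpi.shear hB hξ s)
    fun W' Z hW' hZ x ↦ ?_
  -- `φ` is the coefficient of `ξ` in the shear of `Z`. Because `B` is horizontal it can be computed
  -- on `N`, and is thus constant along the fibers.
  set φ : M → ℝ := (fun y ↦ s * gN.inner y (W y) (W' y)) ∘ pi with hφ
  have hZB (y : M) : s * g.inner y (B y) (Z y) = φ y := by
    rw [hpi.inner_eq (hB.mem_horizontal y), hB.mfderiv_eq, hZ.mfderiv_eq]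
    rfl
  have hψ : MDiffAt (fun y ↦ s * gN.inner y (W y) (W' y)) (pi x) :=
    (contMDiffAt_const.mul (contMDiffAt_inner gN (hW _) (hW' _))).mdifferentiableAt (by simp)
  have hpid : MDiffAt pi x := hpi.contMDiff.mdifferentiable (by simp) x
  have hφd : MDiffAt φ x := hψ.comp x hpid
  have hφ0 (X : Π x : M, TangentSpace 𝓘(ℝ, E) x) (hX : IsVerticalField F pi X) :
      mvfderiv 𝓘(ℝ, E) φ x (X x) = 0 := by
    rw [hφ, mvfderiv_comp_apply x hψ hpid, mem_vertical_iff.1 (hX.mem_vertical x), map_zero]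
  have hφs : ContMDiff 𝓘(ℝ, E) 𝓘(ℝ) ∞ φ := fun y ↦
    (contMDiffAt_const.mul (contMDiffAt_inner gN (hW _) (hW' _))).comp y (hpi.contMDiff y)
  -- The sheared field is the `g`-basic lift of the same `W'`.
  have hZ₀ : IsBasicField g pi W' (Z - φ • ξ) := by
    have e (y : M) : (Z - φ • ξ) y = shearMap g B ξ s y (Z y) := by
      rw [shearMap_apply, hZB]
      rfl
    refine ⟨hZ.contMDiff.sub_section (hφs.smul_section hξ.contMDiff), fun y ↦ ?_, fun y ↦ ?_⟩
    · rw [e]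
      exact hB.shearMap_mem_horizontal hξ (hZ.mem_horizontal y)
    · rw [e, mfderiv_shearMap hξ, hZ.mfderiv_eq]
  obtain ⟨c, hc₀⟩ := hg.exists_lieDerivMetric_eq hE hF hpi hZ₀ x
  obtain ⟨c', hc'⟩ := IsConformalKillingOnFiber.exists_lieDerivMetric_eq hc x
  refine ⟨c + φ x * c', fun X Y hX hY ↦ ?_⟩
  have h1 := lieDerivMetric_add g (X := X) (Y := Y) (hZ₀.mdifferentiableAt x)
    (hφd.smul_section (hξ.mdifferentiableAt x))
  rw [sub_add_cancel, hc₀ X Y hX hY,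
    lieDerivMetric_smul g hφd (hξ.mdifferentiableAt x) (hφ0 X hX) (hφ0 Y hY), hc' X Y hX hY] at h1
  rw [hZ.lieDerivMetric_congr hpi.contMDiff hW' hX hY (hB.shear_inner_of_mem_vertical hξ s),
    hB.shear_inner_of_mem_vertical hξ s _ _ (hX.mem_vertical x) _ (hY.mem_vertical x), h1]
  ring

theorem IsRiemannianSubmersion.existsUmbilicalVariation [FiniteDimensional ℝ F] [T2Space M] [T2Space N] {n p : ℕ}
    (hE : Module.finrank ℝ E = n + p) (hF : Module.finrank ℝ F = p) (hp : 0 < p)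
    (hpi : IsRiemannianSubmersion g gN pi) (hg : HasTotallyUmbilicalFibers F n g pi)
    (hξ : IsVerticalField F pi ξ) (hne : ∃ x, ξ x ≠ 0)
    (hc : ∀ b : N, IsConformalKillingOnFiber F g pi ξ b) :
    ExistsUmbilicalVariation n g gN pi := by
  obtain ⟨x, hx⟩ := hne
  have : Nontrivial (TangentSpace 𝓘(ℝ, F) (pi x)) :=
    Module.nontrivial_of_finrank_pos (R := ℝ) (M := F) (by omega)
  obtain ⟨z, hz⟩ := exists_ne (0 : TangentSpace 𝓘(ℝ, F) (pi x))
  obtain ⟨W, hW, hWx⟩ := exists_contMDiff_field_eq z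
  obtain ⟨B, hB⟩ := hpi.exists_isBasicField hW
  -- Any nonzero parameter in the interval would do: at a point where `B` and `ξ` are nonzero, the
  -- sheared product of `B` and `ξ` is `-s g (B, B) g (ξ, ξ)`, while `g (B, ξ) = 0`.
  refine ⟨1, hB.shear hξ, hB.isVariation_shear hξ, ⟨1 / 2, by norm_num, fun h ↦ ?_⟩,
    fun t _ ↦ ⟨hpi.shear hB hξ t, hasTotallyUmbilicalFibers_shear hE hF hpi hg hW hB hξ hc t⟩⟩
  have hBx : B x ≠ 0 := fun h0 ↦ hz (by rw [← hWx, ← hB.mfderiv_eq x, h0, map_zero])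
  have h1 : (hB.shear hξ (1 / 2)).inner x (B x) (ξ x) = 0 := by
    rw [h]
    exact hB.inner_eq_zero hξ x
  rw [shear_inner_apply, shearMap_of_mem_vertical (hB.mem_horizontal x) _ (hξ.mem_vertical x),
    shearMap_apply, map_sub, sub_apply, hB.inner_eq_zero hξ, map_smul, smul_apply,
    smul_eq_mul] at h1
  have h2 := mul_pos (g.pos x _ hBx) (g.pos x _ hx)
  linarith

end Variation

end RiemSub

end

theorem theorem3p14
    {E : Type*} [NormedAddCommGroup E] [NormedSpace ℝ E] [FiniteDimensional ℝ E]
    {F : Type*} [NormedAddCommGroup F] [NormedSpace ℝ F] [FiniteDimensional ℝ F]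
    {M : Type*} [TopologicalSpace M] [T2Space M] [SecondCountableTopology M]
    [ChartedSpace E M] [IsManifold 𝓘(ℝ, E) ∞ M]
    {N : Type*} [TopologicalSpace N] [T2Space N] [SecondCountableTopology N]
    [ChartedSpace F N] [IsManifold 𝓘(ℝ, F) ∞ N]
    (n p : ℕ) (hE : Module.finrank ℝ E = n + p) (hF : Module.finrank ℝ F = p) (hp : 0 < p)
    (g₀ : RiemSub.Metric E M) (gN : RiemSub.Metric F N) (pi : M → N)
    (hpi : RiemSub.IsRiemannianSubmersion g₀ gN pi)
    (humb : RiemSub.HasTotallyUmbilicalFibers F n g₀ pi) :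
    (RiemSub.ExistsUmbilicalVariation n g₀ gN pi →
      ∃ ξ : Π x : M, TangentSpace 𝓘(ℝ, E) x,
        RiemSub.IsVerticalField F pi ξ ∧ (∃ x, ξ x ≠ 0) ∧
        ∀ b : N, RiemSub.IsConformalKillingOnFiber F g₀ pi ξ b) ∧
    ((∃ ξ : Π x : M, TangentSpace 𝓘(ℝ, E) x,
        RiemSub.IsVerticalField F pi ξ ∧ (∃ x, ξ x ≠ 0) ∧
        (∃ C : ℝ, ∀ x, g₀.inner x (ξ x) (ξ x) ≤ C) ∧
        ∀ b : N, RiemSub.IsConformalKillingOnFiber F g₀ pi ξ b) →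
      RiemSub.ExistsUmbilicalVariation n g₀ gN pi) := by
  constructor
  · rintro ⟨ε, g, hg, ⟨t, ht, hne⟩, h⟩
    exact hpi.exists_conformalKilling hE hF (h t ht).1 humb (h t ht).2 (hg.eq_on t ht) hne
  · rintro ⟨ξ, hξ, hne, -, hc⟩
    exact hpi.existsUmbilicalVariation hE hF hp humb hξ hne hc
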